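/- **Setting.** Consider $N$ nodes and $M$ edges with $$\dot x_i=A_ix_i+B_iu_i+D_iv_i,\quad y_i=C_ix_i\quad(1\le i\le N),\qquad \dot z_j=E_jz_j+F_js_j,\quad w_j=G_jz_j\quad(1\le j\le M),$$ with real matrices, $x_i\in\mathbb R^{n_i}$, $u_i\in\mathbb R^{m_i}$, $z_j\in\mathbb R^{n_{ej}}$ and $y_i,v_i,s_j,w_j\in\mathbb R^p$. Every edge $j$ joins two distinct nodes, its positive and its negative end; $h_{ij}=1$ if node $i$ is the positive end of edge $j$, $h_{ij}=-1$ if it is the negative end, and $h_{ij}=0$ otherwise; $H=(h_{ij})$. The coupling is $v_i=-\sum_j h_{ij}w_j$ and $s_j=\sum_i h_{ij}y_i$. The references of the neighboring inputs $v_i$ are $Q_v\nu_i$ with $\dot\nu_i=S_\eta\nu_i$, $\nu_i\in\mathbb R^q$. A pair $(G_1,G_2)$, where $G_2$ has $p$ columns, *incorporates a $p$-copy internal model of $S_\eta$* if $G_1=T\begin{bmatrix}S_1&S_2\\0&\mathrm{diag}(\alpha_1,\dots,\alpha_p)\end{bmatrix}T^{-1}$ and $G_2=T\begin{bmatrix}S_3\\\mathrm{diag}(\beta_1,\dots,\beta_p)\end{bmatrix}$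 with $T$ invertible, $S_1,S_2,S_3$ arbitrary, and, for every $i$, $\alpha_i$ a square matrix and $\beta_i$ a column such that $(\alpha_i,\beta_i)$ is controllable and the minimal polynomial of $S_\eta$ divides the characteristic polynomial of $\alpha_i$. **Controller.** For $\epsilon>0$ let $$\dot{\bar\eta}_i=G_S\bar\eta_i+\epsilon G_B(v_i-Q_v\nu_i),\qquad \dot\zeta_i=G_{1i}\zeta_i+G_{2i}(y_i-G_Q\bar\eta_i),\qquad u_i=K_{xi}x_i+K_{\zeta i}\zeta_i,$$ where every $(G_{1i},G_{2i})$ incorporates a $p$-copy internal model of $S_\eta$, and, for some $B_\eta\in\mathbb R^{q\times p}$ with columns $B_\eta^k$ and $Q_\eta\in\mathbb R^{p\times q}$ with rows $Q_\eta^k$, $$G_S=I_p\otimes S_\eta,\qquad G_B=\mathrm{diag}(B_\eta^1,\dots,B_\eta^p),\qquad G_Q=\mathrm{diag}(Q_\eta^1,\dots,Q_\eta^p).$$ The pair $(G_S,G_B)$ is controllable and incorporates a $p$-copy internal model of $S_\eta$, and there is a symmetric positive definite $P_\eta$ with $$(I_p\otimes P_\eta)G_S+G_S^T(I_p\otimes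 P_\eta)\le 0,\qquad (I_p\otimes P_\eta)G_B=G_Q^T .$$ **Assumptions.** A1) All $B_i,D_i,F_j$ have full column rank and all $C_i,G_j$ have full row rank. A2) All eigenvalues of $S_\eta$ lie on the imaginary axis and have algebraic multiplicity $1$. A3) Every edge $(E_j,F_j,G_j)$ is strictly positive real: there is a symmetric positive definite $Q_j$ with $Q_jE_j+E_j^TQ_j<0$ and $Q_jF_j=G_j^T$. A4) The network is connected: $\operatorname{rank}H=N-1$. A5) For every $i$, with $\hat A_i=\begin{bmatrix}A_i+B_iK_{xi}&B_iK_{\zeta i}\\G_{2i}C_i&G_{1i}\end{bmatrix}$, $\hat D_i=\begin{bmatrix}D_i\\0\end{bmatrix}$, $\hat C_i=\begin{bmatrix}C_i&0\end{bmatrix}$, the matrix $\hat A_i$ is Hurwitz and the system $\dot\xi=\hat A_i\xi+\hat D_iu$, $y=\hat C_i\xi$ is passive: it has a nonnegative quadratic storage function $V(\xi)=\tfrac12\xi^TP\xi$ with $\dot V\le u^Ty$ for every state $\xi$ and input $u$. A6) The reference trajectories satisfy $\sum_{i=1}^N\nu_i=0$. **Theorem (output cooperation).** Under A1)–A5) there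 is $\epsilon^*>0$ such that for all $0<\epsilon<\epsilon^*$ and for every trajectory on $[0,\infty)$ of the closed-loop system whose references satisfy A6), every neighboring input converges to its reference, $$v_i(t)-Q_v\nu_i(t)\to0\qquad(t\to\infty,\ i=1,\dots,N),$$ and the sum of the node outputs satisfies $$\sum_{i=1}^N y_i(t)-G_Qe^{G_St}\sum_{i=1}^N\bar\eta_i(0)\to0\qquad(t\to\infty).$$ -/

import Mathlib

open Matrix Filter Topology
open scoped Kronecker

/-- A real square matrix is Hurwitz when all its complex eigenvalues have negative real part. -/
def IsHurwitz {ι : Type*} [Fintype ι] [DecidableEq ι] (A : Matrix ι ι ℝ) : Prop :=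
  ∀ μ : ℂ, (A.map (algebraMap ℝ ℂ)).charpoly.IsRoot μ → μ.re < 0

/-- All complex eigenvalues lie on the imaginary axis and have algebraic multiplicity one. -/
def HasSimpleImaginarySpectrum {ι : Type*} [Fintype ι] [DecidableEq ι]
    (S : Matrix ι ι ℝ) : Prop :=
  ∀ μ : ℂ, (S.map (algebraMap ℝ ℂ)).charpoly.IsRoot μ →
    μ.re = 0 ∧ (S.map (algebraMap ℝ ℂ)).charpoly.rootMultiplicity μ = 1

/-- The Kalman controllability matrix `[B, A B, …, A ^ (n - 1) B]`. -/
def controllabilityMatrix {ι κ : Type*} [Fintype ι] [DecidableEq ι]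
    (A : Matrix ι ι ℝ) (B : Matrix ι κ ℝ) : Matrix ι (Fin (Fintype.card ι) × κ) ℝ :=
  Matrix.of fun a kb => (A ^ (kb.1 : ℕ) * B) a kb.2

/-- The pair `(A, B)` is controllable: the controllability matrix has full row rank. -/
def IsControllable {ι κ : Type*} [Fintype ι] [DecidableEq ι] [Fintype κ]
    (A : Matrix ι ι ℝ) (B : Matrix ι κ ℝ) : Prop :=
  (controllabilityMatrix A B).rank = Fintype.card ι

/-- Passivity of `ẋ = A x + B u`, `y = C x`: there is a nonnegative quadratic storage function
`V x = (1/2) xᵀ P x` whose derivative along the system satisfies `V̇ ≤ uᵀ y` for every state `x`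
and every input `u`. -/
def IsPassive {ι κ : Type*} [Fintype ι] [Fintype κ]
    (A : Matrix ι ι ℝ) (B : Matrix ι κ ℝ) (C : Matrix κ ι ℝ) : Prop :=
  ∃ P : Matrix ι ι ℝ, P.PosSemidef ∧
    ∀ (x : ι → ℝ) (u : κ → ℝ), x ⬝ᵥ (P *ᵥ (A *ᵥ x + B *ᵥ u)) ≤ u ⬝ᵥ (C *ᵥ x)

/-- Strict positive realness of the realization `ż = E z + F s`, `w = G z` (no feedthrough),
in its state-space form: `Q E + Eᵀ Q < 0` and `Q F = Gᵀ` for a positive definite `Q`. -/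
def IsStrictlyPositiveReal {ι κ : Type*} [Fintype ι]
    (E : Matrix ι ι ℝ) (F : Matrix ι κ ℝ) (G : Matrix κ ι ℝ) : Prop :=
  ∃ Q : Matrix ι ι ℝ, Q.PosDef ∧ (-(Q * E + Eᵀ * Q)).PosDef ∧ Q * F = Gᵀ

/-- `(G₁, G₂)` incorporates a `p`-copy internal model of `S`:
`G₁ = T [S₁, S₂; 0, diag(α₁, …, α_p)] T⁻¹` and `G₂ = T [S₃; diag(β₁, …, β_p)]` with every
`(αᵢ, βᵢ)` controllable and the minimal polynomial of `S` dividing the characteristic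
polynomial of every `αᵢ`. -/
def IncorporatesPCopy {ι : Type*} [Fintype ι] [DecidableEq ι] {p q : ℕ}
    (S : Matrix (Fin q) (Fin q) ℝ) (G₁ : Matrix ι ι ℝ) (G₂ : Matrix ι (Fin p) ℝ) : Prop :=
  ∃ (r : ℕ) (d : Fin p → ℕ)
    (α : ∀ i, Matrix (Fin (d i)) (Fin (d i)) ℝ) (β : ∀ i, Fin (d i) → ℝ)
    (S₁ : Matrix (Fin r) (Fin r) ℝ) (S₂ : Matrix (Fin r) (Σ i, Fin (d i)) ℝ)
    (S₃ : Matrix (Fin r) (Fin p) ℝ)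
    (T : Matrix ι (Fin r ⊕ Σ i, Fin (d i)) ℝ) (Tinv : Matrix (Fin r ⊕ Σ i, Fin (d i)) ι ℝ),
    T * Tinv = 1 ∧ Tinv * T = 1 ∧
    G₁ = T * Matrix.fromBlocks S₁ S₂ 0 (Matrix.blockDiagonal' α) * Tinv ∧
    G₂ = T * Matrix.fromRows S₃
      (Matrix.of fun (a : Σ i, Fin (d i)) (j : Fin p) => if a.1 = j then β a.1 a.2 else 0) ∧
    ∀ i, IsControllable (α i) (Matrix.replicateCol Unit (β i)) ∧
      minpoly ℝ S ∣ (α i).charpoly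

/-- The data of a multi-agent system with `N` dynamic nodes, `M` dynamic edges and
`p`-dimensional outputs: nodes `ẋᵢ = Aᵢ xᵢ + Bᵢ uᵢ + Dᵢ vᵢ`, `yᵢ = Cᵢ xᵢ`, edges
`żⱼ = Eⱼ zⱼ + Fⱼ sⱼ`, `wⱼ = Gⱼ zⱼ`, and the two (distinct) end nodes of every edge. -/
structure NetworkSystem (N M p : ℕ) where
  n : Fin N → ℕ
  m : Fin N → ℕ
  A : ∀ i, Matrix (Fin (n i)) (Fin (n i)) ℝ
  B : ∀ i, Matrix (Fin (n i)) (Fin (m i)) ℝ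
  C : ∀ i, Matrix (Fin p) (Fin (n i)) ℝ
  D : ∀ i, Matrix (Fin (n i)) (Fin p) ℝ
  ne : Fin M → ℕ
  E : ∀ j, Matrix (Fin (ne j)) (Fin (ne j)) ℝ
  F : ∀ j, Matrix (Fin (ne j)) (Fin p) ℝ
  G : ∀ j, Matrix (Fin p) (Fin (ne j)) ℝ
  posEnd : Fin M → Fin N
  negEnd : Fin M → Fin N
  ends_ne : ∀ j, posEnd j ≠ negEnd j

namespace NetworkSystem

variable {N M p : ℕ}

/-- The incidence matrix of the network. -/
def H (sys : NetworkSystem N M p) : Matrix (Fin N) (Fin M) ℝ :=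
  Matrix.of fun i j => if i = sys.posEnd j then 1 else if i = sys.negEnd j then -1 else 0

/-- The output `yᵢ = Cᵢ xᵢ` of node `i`. -/
def nodeOutput (sys : NetworkSystem N M p) (x : ∀ i, Fin (sys.n i) → ℝ) (i : Fin N) :
    Fin p → ℝ :=
  sys.C i *ᵥ x i

/-- The output `wⱼ = Gⱼ zⱼ` of edge `j`. -/
def edgeOutput (sys : NetworkSystem N M p) (z : ∀ j, Fin (sys.ne j) → ℝ) (j : Fin M) :
    Fin p → ℝ :=
  sys.G j *ᵥ z j

/-- The neighboring input `vᵢ = -∑ⱼ hᵢⱼ wⱼ` of node `i`. -/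
def neighboringInput (sys : NetworkSystem N M p) (z : ∀ j, Fin (sys.ne j) → ℝ) (i : Fin N) :
    Fin p → ℝ :=
  -∑ j, sys.H i j • sys.edgeOutput z j

/-- The input `sⱼ = ∑ᵢ hᵢⱼ yᵢ` of edge `j`. -/
def edgeInput (sys : NetworkSystem N M p) (x : ∀ i, Fin (sys.n i) → ℝ) (j : Fin M) :
    Fin p → ℝ :=
  ∑ i, sys.H i j • sys.nodeOutput x i

/-- Full column rank of all `Bᵢ`, `Dᵢ`, `Fⱼ` and full row rank of all `Cᵢ`, `Gⱼ`. -/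
def FullRank (sys : NetworkSystem N M p) : Prop :=
  (∀ i, (sys.B i).rank = sys.m i ∧ (sys.D i).rank = p ∧ (sys.C i).rank = p) ∧
    ∀ j, (sys.F j).rank = p ∧ (sys.G j).rank = p

/-- Connectedness of the network: the incidence matrix has rank `N - 1`. -/
def Connected (sys : NetworkSystem N M p) : Prop :=
  sys.H.rank + 1 = N

end NetworkSystem

/-- The matrices of the local controllers: internal model dynamics
`ζ̇ᵢ = G₁ᵢ ζᵢ + G₂ᵢ (tracking error)` and feedback `uᵢ = K_xᵢ xᵢ + K_ζᵢ ζᵢ`. -/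
structure LocalController {N M p : ℕ} (sys : NetworkSystem N M p) where
  c : Fin N → ℕ
  G₁ : ∀ i, Matrix (Fin (c i)) (Fin (c i)) ℝ
  G₂ : ∀ i, Matrix (Fin (c i)) (Fin p) ℝ
  Kx : ∀ i, Matrix (Fin (sys.m i)) (Fin (sys.n i)) ℝ
  Kζ : ∀ i, Matrix (Fin (sys.m i)) (Fin (c i)) ℝ

namespace LocalController

variable {N M p : ℕ} {sys : NetworkSystem N M p}

/-- `Âᵢ = [Aᵢ + Bᵢ K_xᵢ, Bᵢ K_ζᵢ; G₂ᵢ Cᵢ, G₁ᵢ]`. -/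
def hatA (ctrl : LocalController sys) (i : Fin N) :
    Matrix (Fin (sys.n i) ⊕ Fin (ctrl.c i)) (Fin (sys.n i) ⊕ Fin (ctrl.c i)) ℝ :=
  Matrix.fromBlocks (sys.A i + sys.B i * ctrl.Kx i) (sys.B i * ctrl.Kζ i)
    (ctrl.G₂ i * sys.C i) (ctrl.G₁ i)

/-- `D̂ᵢ = [Dᵢ; 0]`. -/
def hatD (ctrl : LocalController sys) (i : Fin N) :
    Matrix (Fin (sys.n i) ⊕ Fin (ctrl.c i)) (Fin p) ℝ :=
  Matrix.fromRows (sys.D i) 0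

/-- `Ĉᵢ = [Cᵢ, 0]`. -/
def hatC (ctrl : LocalController sys) (i : Fin N) :
    Matrix (Fin p) (Fin (sys.n i) ⊕ Fin (ctrl.c i)) ℝ :=
  Matrix.fromCols (sys.C i) 0

/-- The gains make `Âᵢ` Hurwitz and `(Âᵢ, D̂ᵢ, Ĉᵢ)` passive, for every node `i`. -/
def Passifies (ctrl : LocalController sys) : Prop :=
  ∀ i, IsHurwitz (ctrl.hatA i) ∧ IsPassive (ctrl.hatA i) (ctrl.hatD i) (ctrl.hatC i)

end LocalController

/-- `G_S = I_p ⊗ S_η`. -/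
def modelS (p : ℕ) {q : ℕ} (Sη : Matrix (Fin q) (Fin q) ℝ) :
    Matrix (Fin p × Fin q) (Fin p × Fin q) ℝ :=
  (1 : Matrix (Fin p) (Fin p) ℝ) ⊗ₖ Sη

/-- `G_B = diag(B_η^1, …, B_η^p)` with `B_η^i` the `i`-th column of `B_η`. -/
def modelB {p q : ℕ} (Bη : Matrix (Fin q) (Fin p) ℝ) : Matrix (Fin p × Fin q) (Fin p) ℝ :=
  Matrix.of fun a j => if a.1 = j then Bη a.2 j else 0

/-- `G_Q = diag(Q_η^1, …, Q_η^p)` with `Q_η^i` the `i`-th row of `Q_η`. -/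
def modelQ {p q : ℕ} (Qη : Matrix (Fin p) (Fin q) ℝ) : Matrix (Fin p) (Fin p × Fin q) ℝ :=
  Matrix.of fun j a => if j = a.1 then Qη j a.2 else 0

/-- `(x, z, η̄, ζ, ν)` is a trajectory on `[0, ∞)` of the network in closed loop with
`η̄̇ᵢ = G_S η̄ᵢ + ε G_B (vᵢ - Q_v νᵢ)`, `ζ̇ᵢ = G₁ᵢ ζᵢ + G₂ᵢ (yᵢ - G_Q η̄ᵢ)`,
`uᵢ = K_xᵢ xᵢ + K_ζᵢ ζᵢ`, where the references are generated by `ν̇ᵢ = S_η νᵢ`. -/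
structure IsClosedLoopTrajectory {N M p q : ℕ} (sys : NetworkSystem N M p)
    (ctrl : LocalController sys) (Sη : Matrix (Fin q) (Fin q) ℝ)
    (Bη : Matrix (Fin q) (Fin p) ℝ) (Qη Qv : Matrix (Fin p) (Fin q) ℝ) (ε : ℝ)
    (x : ℝ → ∀ i, Fin (sys.n i) → ℝ) (z : ℝ → ∀ j, Fin (sys.ne j) → ℝ)
    (ηbar : ℝ → Fin N → Fin p × Fin q → ℝ) (ζ : ℝ → ∀ i, Fin (ctrl.c i) → ℝ)
    (ν : ℝ → Fin N → Fin q → ℝ) : Prop where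
  node : ∀ i, ∀ t ≥ 0, HasDerivWithinAt (fun τ => x τ i)
    (sys.A i *ᵥ x t i + sys.B i *ᵥ (ctrl.Kx i *ᵥ x t i + ctrl.Kζ i *ᵥ ζ t i)
      + sys.D i *ᵥ sys.neighboringInput (z t) i) (Set.Ici 0) t
  edge : ∀ j, ∀ t ≥ 0, HasDerivWithinAt (fun τ => z τ j)
    (sys.E j *ᵥ z t j + sys.F j *ᵥ sys.edgeInput (x t) j) (Set.Ici 0) t
  outputReference : ∀ i, ∀ t ≥ 0, HasDerivWithinAt (fun τ => ηbar τ i)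
    (modelS p Sη *ᵥ ηbar t i
      + ε • (modelB Bη *ᵥ (sys.neighboringInput (z t) i - Qv *ᵥ ν t i))) (Set.Ici 0) t
  internalModel : ∀ i, ∀ t ≥ 0, HasDerivWithinAt (fun τ => ζ τ i)
    (ctrl.G₁ i *ᵥ ζ t i
      + ctrl.G₂ i *ᵥ (sys.nodeOutput (x t) i - modelQ Qη *ᵥ ηbar t i)) (Set.Ici 0) t
  inputReference : ∀ i, ∀ t ≥ 0, HasDerivWithinAt (fun τ => ν τ i)
    (Sη *ᵥ ν t i) (Set.Ici 0) t

/-!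
On a trajectory with zero references the node errors relative to the regulator equations, together
with the output references `η̄ᵢ`, form passive systems up to a term of order `ε` in the input. A
strictly passive storage of the Hurwitz node dynamics absorbs this term at the price of a small
multiple of `‖vᵢ‖²`, which the strictly passive edges pay for when `ε` is small. Hence any two
closed-loop trajectories with the same references have asymptotically equal neighboring inputs and
tracking errors, and it remains to produce one trajectory that tracks the references exactly.

The inputs prescribed to the nodes determine edge states and node outputs through the regulator
equations of the network. Since `P_η S_η + S_ηᵀ P_η` is negative semidefinite and `S_η` is
traceless, it vanishes, and pairing edge inputs with edge outputs in the metric `P_η⁻¹` is a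
strict energy inequality; it makes the network equations injective up to a common node output,
hence solvable for all prescribed inputs of zero sum. Each node output is then reproduced by the
internal model, and it is an output of `(G_S, G_Q)` because matrices commuting with `S_η` act
transitively on the columns of `B_η`, by controllability. Finally `∑ η̄ᵢ` is driven by
`∑ (vᵢ - Q_v νᵢ) = 0`.
-/

section RankMatrices

variable {R ι κ μ : Type*} [Field R] [Fintype κ]

theorem exists_mul_eq_one_of_rank_eq_card [Fintype ι] [DecidableEq ι] {A : Matrix ι κ R}
    (h : A.rank = Fintype.card ι) : ∃ B : Matrix κ ι R, A * B = 1 := by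
  rw [← mulVec_surjective_iff_exists_right_inverse]
  have hrange : LinearMap.range A.mulVecLin = ⊤ :=
    Submodule.eq_top_of_finrank_eq (h.trans (Module.finrank_fintype_fun_eq_card R).symm)
  exact LinearMap.range_eq_top.1 hrange

theorem eq_zero_of_mul_eq_zero_of_rank_eq_card [Finite ι] {A : Matrix ι κ R}
    (h : A.rank = Fintype.card κ) {X : Matrix κ μ R} (hX : A * X = 0) : X = 0 := by
  classical
  cases nonempty_fintype ι
  obtain ⟨B, hB⟩ := exists_mul_eq_one_of_rank_eq_card (A := Aᵀ) (by rw [rank_transpose, h])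
  have hB' : Bᵀ * A = 1 := by simpa using congrArg transpose hB
  rw [← Matrix.one_mul X, ← hB', Matrix.mul_assoc, hX, Matrix.mul_zero]

end RankMatrices

section Sylvester

open Polynomial

theorem mul_aeval_eq_aeval_mul {R ι κ : Type*} [CommRing R] [Fintype ι] [DecidableEq ι]
    [Fintype κ] [DecidableEq κ] {X : Matrix ι κ R} {A : Matrix ι ι R} {S : Matrix κ κ R}
    (h : X * S = A * X) (f : R[X]) : X * aeval S f = aeval A f * X := by
  have hpow (n : ℕ) : X * S ^ n = A ^ n * X := by
    induction n with
    | zero => simp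
    | succ n ih =>
      rw [pow_succ, ← Matrix.mul_assoc, ih, Matrix.mul_assoc, h, pow_succ, Matrix.mul_assoc]
  simp only [aeval_eq_sum_range, Matrix.mul_sum, Matrix.sum_mul, Matrix.mul_smul,
    Matrix.smul_mul, hpow]

theorem exists_mul_sub_mul_eq {K ι κ : Type*} [Field K] [Fintype ι] [DecidableEq ι] [Fintype κ]
    [DecidableEq κ] {A : Matrix ι ι K} {S : Matrix κ κ K} {f : K[X]} (hA : aeval A f = 0)
    (hS : IsUnit (aeval S f)) (R : Matrix ι κ K) : ∃ X : Matrix ι κ K, X * S - A * X = R := by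
  let T : Matrix ι κ K →ₗ[K] Matrix ι κ K := mulRightLinearMap ι K S - mulLeftLinearMap κ K A
  suffices hT : Function.Injective T from LinearMap.injective_iff_surjective.1 hT R
  refine (injective_iff_map_eq_zero T).2 fun X hX => ?_
  have hXf : X * aeval S f = 0 := by
    rw [mul_aeval_eq_aeval_mul (sub_eq_zero.1 hX : X * S = A * X) f, hA, Matrix.zero_mul]
  obtain ⟨V, hV⟩ := hS.exists_right_inv
  rw [← Matrix.mul_one X, ← hV, ← Matrix.mul_assoc, hXf, Matrix.zero_mul]

end Sylvester

section Spectrum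

open Polynomial

variable {ι κ : Type*} [Fintype ι] [DecidableEq ι] [Fintype κ] [DecidableEq κ]

theorem isRoot_charpoly_map_iff {A : Matrix ι ι ℝ} {μ : ℂ} :
    (A.map (algebraMap ℝ ℂ)).charpoly.IsRoot μ ↔ aeval μ A.charpoly = 0 := by
  rw [IsRoot.def, charpoly_map, eval_map_algebraMap]

theorem IsHurwitz.isCoprime_charpoly_minpoly {A : Matrix ι ι ℝ} (hA : IsHurwitz A)
    {S : Matrix κ κ ℝ}
    (hS : ∀ μ : ℂ, (S.map (algebraMap ℝ ℂ)).charpoly.IsRoot μ → 0 ≤ μ.re) :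
    IsCoprime A.charpoly (minpoly ℝ S) := by
  refine (isCoprime_iff_aeval_ne_zero_of_isAlgClosed ℝ ℂ _ _).2 fun μ => ?_
  by_contra! h
  have hSμ : aeval μ S.charpoly = 0 := aeval_eq_zero_of_dvd_aeval_eq_zero
    S.minpoly_dvd_charpoly h.2
  exact (hS μ (isRoot_charpoly_map_iff.2 hSμ)).not_gt (hA μ (isRoot_charpoly_map_iff.2 h.1))

theorem trace_eq_zero_of_forall_re_eq_zero {S : Matrix κ κ ℝ}
    (hS : ∀ μ : ℂ, (S.map (algebraMap ℝ ℂ)).charpoly.IsRoot μ → μ.re = 0) : S.trace = 0 := by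
  have htrace : (S.trace : ℂ) = (S.map (algebraMap ℝ ℂ)).charpoly.roots.sum := by
    simp [← trace_eq_sum_roots_charpoly, Matrix.trace]
  have hre : S.trace = ((S.map (algebraMap ℝ ℂ)).charpoly.roots.map Complex.reCLM).sum := by
    rw [← map_multiset_sum, ← htrace, Complex.reCLM_apply, Complex.ofReal_re]
  rw [hre]
  refine Multiset.sum_eq_zero fun x hx => ?_
  obtain ⟨μ, hμ, rfl⟩ := Multiset.mem_map.1 hx
  exact hS μ (isRoot_of_mem_roots hμ)

end Spectrum

section WeightedTrace

variable {ι κ : Type*} [Fintype ι] [Fintype κ]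

theorem trace_mul_mul_mul_transpose_pos {R : Matrix ι ι ℝ} {W : Matrix κ κ ℝ} (hR : R.PosDef)
    (hW : W.PosDef) {Z : Matrix ι κ ℝ} (hZ : Z ≠ 0) : 0 < (R * Z * W * Zᵀ).trace := by
  have hWt : Wᵀ = W := hW.isHermitian
  have hvec : (R * Z * W * Zᵀ).trace = vec Z ⬝ᵥ ((W ⊗ₖ R) *ᵥ vec Z) := by
    rw [kronecker_mulVec_vec, vec_dotProduct_vec, hWt, trace_mul_comm]
  rw [hvec]
  exact (hW.kronecker hR).dotProduct_mulVec_pos fun h => hZ (vec_eq_zero_iff.1 h)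

theorem trace_mul_mul_mul_transpose_nonneg {R : Matrix ι ι ℝ} {W : Matrix κ κ ℝ} (hR : R.PosDef)
    (hW : W.PosDef) (Z : Matrix ι κ ℝ) : 0 ≤ (R * Z * W * Zᵀ).trace := by
  rcases eq_or_ne Z 0 with rfl | hZ
  · simp
  · exact (trace_mul_mul_mul_transpose_pos hR hW hZ).le

open scoped MatrixOrder in
theorem eq_zero_of_trace_mul_eq_zero {R N : Matrix ι ι ℝ} (hR : R.PosDef) (hN : N.PosSemidef)
    (h : (R * N).trace = 0) : N = 0 := by
  classical
  obtain ⟨C, hC⟩ := CStarAlgebra.nonneg_iff_eq_star_mul_self.1 hN.nonneg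
  replace hC : N = Cᵀ * C := hC
  by_contra hne
  have hC0 : C ≠ 0 := by rintro rfl; exact hne (by simp [hC])
  have hpos := trace_mul_mul_mul_transpose_pos PosDef.one hR hC0
  rw [Matrix.one_mul, trace_mul_comm, ← Matrix.mul_assoc, trace_mul_comm, ← hC] at hpos
  exact hpos.ne' h

theorem lyapunov_eq_zero_of_trace_eq_zero {P S : Matrix κ κ ℝ} (hP : P.PosDef)
    (hS : S.trace = 0) (h : (-(P * S + Sᵀ * P)).PosSemidef) : P * S + Sᵀ * P = 0 := by
  classical
  have hdet : IsUnit P.det := (isUnit_iff_isUnit_det P).1 hP.isUnit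
  refine neg_eq_zero.1 (eq_zero_of_trace_mul_eq_zero hP.inv h ?_)
  have hleft : (P⁻¹ * (P * S)).trace = 0 := by rw [nonsing_inv_mul_cancel_left _ _ hdet, hS]
  have hright : (P⁻¹ * (Sᵀ * P)).trace = 0 := by
    rw [trace_mul_comm, mul_nonsing_inv_cancel_right _ _ hdet, trace_transpose, hS]
  rw [Matrix.mul_neg, trace_neg, Matrix.mul_add, trace_add, hleft, hright, add_zero, neg_zero]

theorem mul_inv_add_inv_mul_transpose_eq_zero [DecidableEq κ] {P S : Matrix κ κ ℝ}
    (hP : IsUnit P.det) (h : P * S + Sᵀ * P = 0) : S * P⁻¹ + P⁻¹ * Sᵀ = 0 := by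
  calc S * P⁻¹ + P⁻¹ * Sᵀ = P⁻¹ * (P * S + Sᵀ * P) * P⁻¹ := by
        rw [Matrix.mul_add, Matrix.add_mul, nonsing_inv_mul_cancel_left _ _ hP,
          ← Matrix.mul_assoc, mul_nonsing_inv_cancel_right _ _ hP]
    _ = 0 := by rw [h, Matrix.mul_zero, Matrix.zero_mul]

end WeightedTrace

section Controllability

open Polynomial

variable {ι κ : Type*} [Fintype ι] [DecidableEq ι] [Fintype κ]

theorem IsControllable.exists_sum_aeval_mulVec_eq {A : Matrix ι ι ℝ} {B : Matrix ι κ ℝ}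
    (h : IsControllable A B) (y : ι → ℝ) :
    ∃ f : κ → ℝ[X], ∑ k, aeval A (f k) *ᵥ B.col k = y := by
  classical
  obtain ⟨D, hD⟩ := exists_mul_eq_one_of_rank_eq_card h
  set c := D *ᵥ y with hc
  have hy : controllabilityMatrix A B *ᵥ c = y := by rw [hc, mulVec_mulVec, hD, one_mulVec]
  refine ⟨fun k => ∑ a : Fin (Fintype.card ι), C (c (a, k)) * X ^ (a : ℕ), ?_⟩
  rw [← hy]
  ext i
  simp only [map_sum, map_mul, map_pow, aeval_C, aeval_X, Algebra.algebraMap_eq_smul_one,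
    smul_one_mul, sum_mulVec, smul_mulVec, Finset.sum_apply, Pi.smul_apply, smul_eq_mul]
  rw [Finset.sum_comm, mulVec, dotProduct, Fintype.sum_prod_type]
  refine Finset.sum_congr rfl fun a _ => Finset.sum_congr rfl fun k _ => ?_
  rw [mul_comm]
  rfl

theorem IsControllable.exists_forall_dotProduct_pow_mulVec_eq {α : Matrix ι ι ℝ} {β : ι → ℝ}
    (h : IsControllable α (replicateCol Unit β)) (g : ℕ → ℝ) :
    ∃ w : ι → ℝ, ∀ a < Fintype.card ι, w ⬝ᵥ (α ^ a *ᵥ β) = g a := by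
  obtain ⟨D, hD⟩ := exists_mul_eq_one_of_rank_eq_card h
  replace hD := (mul_eq_one_comm_of_card_eq _ _ _ (by simp)).1 hD
  refine ⟨(fun a => g a.1) ᵥ* D, fun a ha => ?_⟩
  have hmoment (w : ι → ℝ) : w ⬝ᵥ (α ^ a *ᵥ β)
      = (w ᵥ* controllabilityMatrix α (replicateCol Unit β)) (⟨a, ha⟩, ()) := rfl
  rw [hmoment, vecMul_vecMul, hD, vecMul_one]

theorem vecMul_mul_aeval_eq [DecidableEq κ] {α : Matrix ι ι ℝ} {β : ι → ℝ} {S : Matrix κ κ ℝ}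
    {Z : Matrix ι κ ℝ} {e : κ → ℝ} (hZ : Z * S = α * Z + vecMulVec β e) {f : ℝ[X]}
    (hf : f.Monic) (hdeg : 0 < f.natDegree) {w : ι → ℝ}
    (hw : ∀ a < f.natDegree, w ⬝ᵥ (α ^ a *ᵥ β) = if a + 1 = f.natDegree then 1 else 0) :
    w ᵥ* (Z * aeval S f) = w ᵥ* (aeval α f * Z) + e := by
  have hstep (a : ℕ) : w ᵥ* (α ^ a * Z) ᵥ* S
      = w ᵥ* (α ^ (a + 1) * Z) + (w ⬝ᵥ (α ^ a *ᵥ β)) • e := by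
    rw [vecMul_vecMul, Matrix.mul_assoc, hZ, Matrix.mul_add, vecMul_add, ← Matrix.mul_assoc,
      ← pow_succ, mul_vecMulVec, vecMul_vecMulVec]
  have hlow {a : ℕ} (ha : a < f.natDegree) : w ᵥ* (Z * S ^ a) = w ᵥ* (α ^ a * Z) := by
    induction a with
    | zero => simp
    | succ a ih =>
      rw [pow_succ, ← Matrix.mul_assoc, ← vecMul_vecMul, ih (by omega), hstep, hw a (by omega),
        if_neg ha.ne, zero_smul, add_zero]
  have htop : w ᵥ* (Z * S ^ f.natDegree) = w ᵥ* (α ^ f.natDegree * Z) + e := by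
    obtain ⟨d, hd⟩ := Nat.exists_eq_succ_of_ne_zero hdeg.ne'
    rw [hd, pow_succ, ← Matrix.mul_assoc, ← vecMul_vecMul, hlow (by omega), hstep,
      hw d (by omega), if_pos hd.symm, one_smul]
  rw [aeval_eq_sum_range, aeval_eq_sum_range, Finset.sum_range_succ, Finset.sum_range_succ,
    hf.coeff_natDegree, one_smul, one_smul, Matrix.mul_add, Matrix.add_mul, vecMul_add,
    vecMul_add, htop, add_assoc, Matrix.mul_sum, Matrix.sum_mul, vecMul_sum, vecMul_sum]
  congr 1
  refine Finset.sum_congr rfl fun a ha => ?_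
  rw [Matrix.mul_smul, Matrix.smul_mul, vecMul_smul, vecMul_smul, hlow (Finset.mem_range.1 ha)]

theorem eq_zero_of_isControllable_of_aeval_charpoly_eq_zero [DecidableEq κ] {α : Matrix ι ι ℝ}
    {β : ι → ℝ} (h : IsControllable α (replicateCol Unit β)) {S : Matrix κ κ ℝ}
    (hS : aeval S α.charpoly = 0) {Z : Matrix ι κ ℝ} {e : κ → ℝ}
    (hZ : Z * S = α * Z + vecMulVec β e) : e = 0 := by
  have hdeg : α.charpoly.natDegree = Fintype.card ι := charpoly_natDegree_eq_dim α
  rcases Nat.eq_zero_or_pos (Fintype.card ι) with hι | hι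
  · have h1 : (1 : Matrix κ κ ℝ) = 0 := by
      rwa [α.charpoly_monic.natDegree_eq_zero.1 (hdeg.trans hι), map_one] at hS
    rw [← vecMul_one e, h1, vecMul_zero]
  · obtain ⟨w, hw⟩ := h.exists_forall_dotProduct_pow_mulVec_eq
      fun a => if a + 1 = Fintype.card ι then 1 else 0
    rw [← hdeg] at hι hw
    have h0e := vecMul_mul_aeval_eq hZ α.charpoly_monic hι hw
    rwa [hS, aeval_self_charpoly, Matrix.mul_zero, Matrix.zero_mul, vecMul_zero, zero_add,
      eq_comm] at h0e

end Controllability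

section InternalModel

open Polynomial

variable {ι κ : Type*} [Fintype ι] [DecidableEq ι]

theorem blockDiagonal'_mul_submatrix {R o : Type*} [Semiring R] [Fintype o] [DecidableEq o]
    {d : o → Type*} [∀ k, Fintype (d k)] (α : ∀ k, Matrix (d k) (d k) R)
    (W : Matrix (Σ k, d k) κ R) (k : o) :
    (blockDiagonal' α * W).submatrix (Sigma.mk k) id = α k * W.submatrix (Sigma.mk k) id := by
  ext a b
  simp only [submatrix_apply, id_eq, mul_apply, Fintype.sum_sigma]
  rw [Fintype.sum_eq_single k fun k' hk' => Finset.sum_eq_zero fun a' _ => by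
    rw [blockDiagonal'_apply_ne _ _ _ hk'.symm, zero_mul]]
  simp only [blockDiagonal'_apply_eq]

theorem IncorporatesPCopy.error_eq_zero [Fintype κ] [DecidableEq κ] {p q : ℕ}
    {Sη : Matrix (Fin q) (Fin q) ℝ} {G₁ : Matrix ι ι ℝ} {G₂ : Matrix ι (Fin p) ℝ}
    (h : IncorporatesPCopy Sη G₁ G₂) {S : Matrix κ κ ℝ} (hS : aeval S (minpoly ℝ Sη) = 0)
    {Z : Matrix ι κ ℝ} {e : Matrix (Fin p) κ ℝ} (hZ : Z * S = G₁ * Z + G₂ * e) : e = 0 := by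
  obtain ⟨r, d, α, β, S₁, S₂, S₃, T, Tinv, -, hT, rfl, rfl, hαβ⟩ := h
  set b : Matrix (Σ i, Fin (d i)) (Fin p) ℝ := Matrix.of fun a j => if a.1 = j then β a.1 a.2 else 0
  set W := Tinv * Z with hW
  have hWS : W * S = fromBlocks S₁ S₂ 0 (blockDiagonal' α) * W + fromRows S₃ b * e := by
    rw [hW, Matrix.mul_assoc, hZ, Matrix.mul_add]
    simp only [← Matrix.mul_assoc, hT, Matrix.one_mul]
  have hcopies : W.toRows₂ * S = blockDiagonal' α * W.toRows₂ + b * e := by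
    rw [← fromRows_toRows W, fromRows_mul, fromBlocks_mul_fromRows, fromRows_mul,
      Matrix.zero_mul, zero_add] at hWS
    exact congrArg toRows₂ hWS
  ext1 k
  have hcopy : W.toRows₂.submatrix (Sigma.mk k) id * S
      = α k * W.toRows₂.submatrix (Sigma.mk k) id + vecMulVec (β k) (e k) := by
    have hb : (b * e).submatrix (Sigma.mk k) id = vecMulVec (β k) (e k) := by
      ext
      simp [b, mul_apply, vecMulVec_apply]
    rw [← blockDiagonal'_mul_submatrix, ← hb]
    exact congrArg (·.submatrix (Sigma.mk k) id) hcopies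
  exact congrFun (eq_zero_of_isControllable_of_aeval_charpoly_eq_zero (hαβ k).1
    (aeval_eq_zero_of_dvd_aeval_eq_zero (hαβ k).2 hS) hcopy)

theorem IncorporatesPCopy.exists_regulator [Fintype κ] [DecidableEq κ] {n m : Type*} [Fintype n]
    [DecidableEq n] [Fintype m] {p q : ℕ} {Sη : Matrix (Fin q) (Fin q) ℝ} {A : Matrix n n ℝ}
    {B : Matrix n m ℝ} {C : Matrix (Fin p) n ℝ} {Kx : Matrix m n ℝ} {Kζ : Matrix m ι ℝ}
    {G₁ : Matrix ι ι ℝ} {G₂ : Matrix ι (Fin p) ℝ}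
    (h : IncorporatesPCopy Sη G₁ G₂) {S : Matrix κ κ ℝ} (hS : aeval S (minpoly ℝ Sη) = 0)
    (hcop : IsCoprime (fromBlocks (A + B * Kx) (B * Kζ) (G₂ * C) G₁).charpoly (minpoly ℝ Sη))
    (R : Matrix n κ ℝ) (Y : Matrix (Fin p) κ ℝ) :
    ∃ (X : Matrix n κ ℝ) (Z : Matrix ι κ ℝ),
      X * S = A * X + B * (Kx * X + Kζ * Z) + R ∧ Z * S = G₁ * Z ∧ C * X = Y := by
  set Â := fromBlocks (A + B * Kx) (B * Kζ) (G₂ * C) G₁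
  have hu : IsUnit (aeval S Â.charpoly) := by
    obtain ⟨a, b, hab⟩ := hcop
    have hSab := congrArg (aeval S) hab
    rw [map_add, map_mul, map_mul, hS, mul_zero, add_zero, map_one] at hSab
    exact IsUnit.of_mul_eq_one_right _ hSab
  obtain ⟨W, hW⟩ := exists_mul_sub_mul_eq (aeval_self_charpoly Â) hu (fromRows R (-(G₂ * Y)))
  rw [sub_eq_iff_eq_add, ← fromRows_toRows W, fromRows_mul, fromBlocks_mul_fromRows] at hW
  have hX : W.toRows₁ * S = R + ((A + B * Kx) * W.toRows₁ + B * Kζ * W.toRows₂) :=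
    congrArg toRows₁ hW
  have hZ : W.toRows₂ * S = -(G₂ * Y) + (G₂ * C * W.toRows₁ + G₁ * W.toRows₂) :=
    congrArg toRows₂ hW
  have htrack : C * W.toRows₁ = Y := by
    refine sub_eq_zero.1 (h.error_eq_zero hS (Z := W.toRows₂) ?_)
    rw [hZ, Matrix.mul_sub, Matrix.mul_assoc]
    abel
  refine ⟨W.toRows₁, W.toRows₂, ?_, ?_, htrack⟩
  · rw [hX, Matrix.add_mul, Matrix.mul_add, Matrix.mul_assoc, Matrix.mul_assoc]
    abel
  · rw [hZ, Matrix.mul_assoc, htrack]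
    abel

end InternalModel

section OutputModel

open Polynomial

variable {p q : ℕ}

theorem aeval_one_kronecker {R o κ : Type*} [CommRing R] [Fintype o] [DecidableEq o] [Fintype κ]
    [DecidableEq κ] (S : Matrix κ κ R) (f : R[X]) :
    aeval ((1 : Matrix o o R) ⊗ₖ S) f = (1 : Matrix o o R) ⊗ₖ aeval S f := by
  let φ : Matrix κ κ R →ₐ[R] Matrix (o × κ) (o × κ) R :=
    AlgHom.ofLinearMap (kroneckerBilinear (R := R) (1 : Matrix o o R)) one_kronecker_one
      fun A B => by
        have h := mul_kronecker_mul (1 : Matrix o o R) (1 : Matrix o o R) A B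
        rwa [Matrix.one_mul] at h
  exact aeval_algHom_apply φ S f

theorem aeval_modelS_minpoly (p : ℕ) (S : Matrix (Fin q) (Fin q) ℝ) :
    aeval (modelS p S) (minpoly ℝ S) = 0 := by
  rw [modelS, aeval_one_kronecker, minpoly.aeval, kronecker_zero]

theorem modelS_mul_apply {o : Type*} (S : Matrix (Fin q) (Fin q) ℝ)
    (X : Matrix (Fin p × Fin q) o ℝ) (k : Fin p) (b : Fin q) (j : o) :
    (modelS p S * X) (k, b) j = ∑ b', S b b' * X (k, b') j := by
  simp [modelS, mul_apply, Fintype.sum_prod_type, kroneckerMap_apply, one_apply, ite_mul]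

theorem mul_modelS_apply {o : Type*} (S : Matrix (Fin q) (Fin q) ℝ)
    (X : Matrix o (Fin p × Fin q) ℝ) (i : o) (k : Fin p) (b : Fin q) :
    (X * modelS p S) i (k, b) = ∑ b', X i (k, b') * S b' b := by
  simp [modelS, mul_apply, Fintype.sum_prod_type, kroneckerMap_apply, one_apply]

theorem modelQ_mul_apply {o : Type*} (Q : Matrix (Fin p) (Fin q) ℝ)
    (X : Matrix (Fin p × Fin q) o ℝ) (k : Fin p) (j : o) :
    (modelQ Q * X) k j = ∑ b, Q k b * X (k, b) j := by
  simp [modelQ, mul_apply, Fintype.sum_prod_type, ite_mul]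

theorem lyapunov_modelS (P S : Matrix (Fin q) (Fin q) ℝ) :
    ((1 : Matrix (Fin p) (Fin p) ℝ) ⊗ₖ P) * modelS p S
      + (modelS p S)ᵀ * ((1 : Matrix (Fin p) (Fin p) ℝ) ⊗ₖ P)
      = (1 : Matrix (Fin p) (Fin p) ℝ) ⊗ₖ (P * S + Sᵀ * P) := by
  rw [modelS, ← kroneckerMap_transpose, transpose_one, ← mul_kronecker_mul, ← mul_kronecker_mul,
    Matrix.one_mul, kronecker_add]

theorem lyapunov_posSemidef_of_modelS [NeZero p] {P S : Matrix (Fin q) (Fin q) ℝ}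
    (h : (-(((1 : Matrix (Fin p) (Fin p) ℝ) ⊗ₖ P) * modelS p S
      + (modelS p S)ᵀ * ((1 : Matrix (Fin p) (Fin p) ℝ) ⊗ₖ P))).PosSemidef) :
    (-(P * S + Sᵀ * P)).PosSemidef := by
  rw [lyapunov_modelS] at h
  convert h.submatrix (fun b : Fin q => ((0 : Fin p), b)) using 1
  ext
  simp [kroneckerMap_apply]

theorem row_eq_col_vecMul_of_kronecker_mul_modelB {P : Matrix (Fin q) (Fin q) ℝ}
    {B : Matrix (Fin q) (Fin p) ℝ} {Q : Matrix (Fin p) (Fin q) ℝ} (hP : P.IsSymm)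
    (h : ((1 : Matrix (Fin p) (Fin p) ℝ) ⊗ₖ P) * modelB B = (modelQ Q)ᵀ) (k : Fin p) :
    Q.row k = B.col k ᵥ* P := by
  have hcol : P *ᵥ B.col k = Q.row k := by
    ext b
    have hkb := congrFun (congrFun h (k, b)) k
    rw [← modelS, modelS_mul_apply] at hkb
    simpa [modelB, modelQ, mulVec, dotProduct] using hkb
  rw [← hcol, ← vecMul_transpose, hP.eq]

theorem exists_commute_mulVec_col_eq {S : Matrix (Fin q) (Fin q) ℝ} {B : Matrix (Fin q) (Fin p) ℝ}
    (h : IsControllable (modelS p S) (modelB B)) (k : Fin p) (y : Fin q → ℝ) :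
    ∃ L : Matrix (Fin q) (Fin q) ℝ, Commute L S ∧ L *ᵥ B.col k = y := by
  obtain ⟨f, hf⟩ := h.exists_sum_aeval_mulVec_eq fun a => y a.2
  refine ⟨aeval S (f k), (mul_aeval_eq_aeval_mul rfl (f k)).symm, ?_⟩
  ext b
  have hcol (j : Fin p) : (aeval (modelS p S) (f j) *ᵥ (modelB B).col j) (k, b)
      = if k = j then (aeval S (f k) *ᵥ B.col k) b else 0 := by
    rw [modelS, aeval_one_kronecker]
    split_ifs with hkj
    · subst hkj
      simp [mulVec, dotProduct, Fintype.sum_prod_type, kroneckerMap_apply, one_apply, modelB]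
    · simp [mulVec, dotProduct, Fintype.sum_prod_type, kroneckerMap_apply, one_apply, modelB, hkj]
  simpa [hcol] using congrFun hf (k, b)

theorem commute_inv_mul_transpose_mul {P S L : Matrix (Fin q) (Fin q) ℝ} (hP : IsUnit P.det)
    (hPS : P * S + Sᵀ * P = 0) (hL : Commute L S) : Commute S (P⁻¹ * Lᵀ * P) := by
  have hS : S * P⁻¹ = -(P⁻¹ * Sᵀ) :=
    eq_neg_of_add_eq_zero_left (mul_inv_add_inv_mul_transpose_eq_zero hP hPS)
  have hLt : Sᵀ * Lᵀ = Lᵀ * Sᵀ := by rw [← transpose_mul, ← transpose_mul, hL.eq]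
  calc S * (P⁻¹ * Lᵀ * P) = -(P⁻¹ * (Sᵀ * Lᵀ) * P) := by
        simp only [← Matrix.mul_assoc, hS, Matrix.neg_mul]
    _ = P⁻¹ * Lᵀ * -(Sᵀ * P) := by
        rw [hLt]
        simp only [Matrix.mul_assoc, Matrix.mul_neg]
    _ = P⁻¹ * Lᵀ * P * S := by
        rw [← eq_neg_of_add_eq_zero_left hPS, ← Matrix.mul_assoc]

theorem exists_model_realization {P S : Matrix (Fin q) (Fin q) ℝ} {B : Matrix (Fin q) (Fin p) ℝ}
    {Q : Matrix (Fin p) (Fin q) ℝ} (hP : P.PosDef) (hPS : P * S + Sᵀ * P = 0)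
    (h : IsControllable (modelS p S) (modelB B))
    (hGB : ((1 : Matrix (Fin p) (Fin p) ℝ) ⊗ₖ P) * modelB B = (modelQ Q)ᵀ) {N : ℕ}
    (Y : Matrix (Fin p) (Fin N × Fin q) ℝ) :
    ∃ X : Matrix (Fin p × Fin q) (Fin N × Fin q) ℝ,
      modelS p S * X = X * modelS N S ∧ modelQ Q * X = Y := by
  have hdet : IsUnit P.det := (isUnit_iff_isUnit_det P).1 hP.isUnit
  have hsymm : P.IsSymm := hP.isHermitian
  choose L hL hLB using
    fun k l => exists_commute_mulVec_col_eq h k ((fun b => Y k (l, b)) ᵥ* P⁻¹)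
  refine ⟨Matrix.of fun a c => (P⁻¹ * (L a.1 c.1)ᵀ * P) a.2 c.2, ?_, ?_⟩
  · ext ⟨k, b⟩ ⟨l, c⟩
    rw [modelS_mul_apply, mul_modelS_apply]
    exact congrFun (congrFun (commute_inv_mul_transpose_mul hdet hPS (hL k l)).eq b) c
  · ext k ⟨l, c⟩
    have hrow : Q.row k ᵥ* (P⁻¹ * (L k l)ᵀ * P) = fun b => Y k (l, b) := by
      rw [row_eq_col_vecMul_of_kronecker_mul_modelB hsymm hGB, vecMul_vecMul,
        Matrix.mul_assoc, mul_nonsing_inv_cancel_left _ _ hdet, ← vecMul_vecMul, vecMul_transpose,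
        hLB, vecMul_vecMul, nonsing_inv_mul _ hdet, vecMul_one]
    rw [modelQ_mul_apply]
    exact congrFun hrow c

end OutputModel

namespace NetworkSystem

variable {N M p : ℕ}

theorem H_apply (sys : NetworkSystem N M p) (i : Fin N) (j : Fin M) :
    sys.H i j = (if i = sys.posEnd j then 1 else 0) - (if i = sys.negEnd j then 1 else 0) := by
  have := sys.ends_ne j
  simp only [H, Matrix.of_apply]
  split_ifs <;> simp_all

theorem sum_H (sys : NetworkSystem N M p) (j : Fin M) : ∑ i, sys.H i j = 0 := by
  simp [H_apply]

theorem Connected.pos {sys : NetworkSystem N M p} (h : sys.Connected) : 0 < N :=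
  Nat.lt_of_lt_of_eq (Nat.succ_pos _) h

theorem Connected.finrank_ker_eq_one {sys : NetworkSystem N M p} (h : sys.Connected) :
    Module.finrank ℝ (LinearMap.ker sys.Hᵀ.mulVecLin) = 1 := by
  have hrank : Module.finrank ℝ (LinearMap.range sys.Hᵀ.mulVecLin) + 1 = N := by
    rw [← Matrix.rank, rank_transpose]
    exact h
  have hsum := LinearMap.finrank_range_add_finrank_ker sys.Hᵀ.mulVecLin
  rw [Module.finrank_fintype_fun_eq_card, Fintype.card_fin] at hsum
  omega

theorem Connected.eq_zero_of_sum_eq_zero {sys : NetworkSystem N M p} (h : sys.Connected)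
    {c : Fin N → ℝ} (hc : sys.Hᵀ *ᵥ c = 0) (hsum : ∑ i, c i = 0) : c = 0 := by
  have hone : sys.Hᵀ *ᵥ 1 = 0 := by
    ext j
    simpa [mulVec, dotProduct] using sys.sum_H j
  have : NeZero N := ⟨h.pos.ne'⟩
  have hne : (⟨1, hone⟩ : LinearMap.ker sys.Hᵀ.mulVecLin) ≠ 0 :=
    fun h0 => one_ne_zero (congrArg Subtype.val h0)
  obtain ⟨a, ha⟩ := (finrank_eq_one_iff_of_nonzero' _ hne).1 h.finrank_ker_eq_one ⟨c, hc⟩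
  obtain rfl : a • 1 = c := congrArg Subtype.val ha
  have ha0 : a = 0 := by simpa [h.pos.ne'] using hsum
  rw [ha0, zero_smul]

end NetworkSystem

section ModeSteadyState

theorem trace_mul_eq_zero_of_transpose_eq_neg {ι : Type*} [Fintype ι] {Q K : Matrix ι ι ℝ}
    (hQ : Q.IsSymm) (hK : Kᵀ = -K) : (Q * K).trace = 0 := by
  have h : (Q * K).trace = -(Q * K).trace := by
    conv_lhs => rw [← trace_transpose, transpose_mul, hQ.eq, hK, Matrix.neg_mul, trace_neg,
      trace_mul_comm]
  linarith

variable {ι κ o : Type*} [Fintype ι] [Fintype κ] [Fintype o]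

theorem two_mul_trace_mul_mul_transpose {E Q : Matrix ι ι ℝ} {F : Matrix ι o ℝ} {G : Matrix o ι ℝ}
    {S W : Matrix κ κ ℝ} (hQ : Q.IsSymm) (hQF : Q * F = Gᵀ) (hW : W.IsSymm)
    (hSW : S * W + W * Sᵀ = 0) {Z : Matrix ι κ ℝ} {s : Matrix o κ ℝ}
    (hZ : Z * S = E * Z + F * s) :
    2 * (s * W * (G * Z)ᵀ).trace = (-(Q * E + Eᵀ * Q) * Z * W * Zᵀ).trace := by
  have hpower : (s * W * (G * Z)ᵀ).trace = (Q * (F * s * W * Zᵀ)).trace := by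
    rw [transpose_mul, ← hQF, ← Matrix.mul_assoc, trace_mul_comm]
    simp only [Matrix.mul_assoc]
  have hrotation : (Q * (Z * S * W * Zᵀ)).trace = 0 := by
    refine trace_mul_eq_zero_of_transpose_eq_neg hQ ?_
    have hWS : W * Sᵀ = -(S * W) := eq_neg_of_add_eq_zero_right hSW
    simp only [transpose_mul, transpose_transpose, hW.eq]
    rw [← Matrix.mul_assoc W, hWS, Matrix.neg_mul, Matrix.mul_neg]
    simp only [Matrix.mul_assoc]
  have hadjoint : (Eᵀ * Q * (Z * W * Zᵀ)).trace = (Q * E * (Z * W * Zᵀ)).trace := by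
    rw [← trace_transpose]
    simp only [transpose_mul, transpose_transpose, hQ.eq, hW.eq]
    rw [trace_mul_comm]
    simp only [Matrix.mul_assoc]
  have hdissipation :
      (-(Q * E + Eᵀ * Q) * Z * W * Zᵀ).trace = -2 * (Q * E * (Z * W * Zᵀ)).trace := by
    rw [Matrix.mul_assoc, Matrix.mul_assoc, ← Matrix.mul_assoc Z, Matrix.neg_mul, Matrix.add_mul,
      trace_neg, trace_add, hadjoint]
    ring
  rw [hpower, hdissipation, eq_sub_of_add_eq' hZ.symm]
  simp only [Matrix.sub_mul, Matrix.mul_sub, trace_sub, hrotation]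
  simp only [Matrix.mul_assoc]
  ring

theorem IsStrictlyPositiveReal.trace_mul_output_pos {E : Matrix ι ι ℝ} {F : Matrix ι o ℝ}
    {G : Matrix o ι ℝ} (h : IsStrictlyPositiveReal E F G) {S W : Matrix κ κ ℝ} (hW : W.PosDef)
    (hSW : S * W + W * Sᵀ = 0) {Z : Matrix ι κ ℝ} {s : Matrix o κ ℝ}
    (hZ : Z * S = E * Z + F * s) (hZ0 : Z ≠ 0) : 0 < (s * W * (G * Z)ᵀ).trace := by
  obtain ⟨Q, hQ, hQE, hQF⟩ := h
  have hQsymm : Q.IsSymm := hQ.isHermitian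
  have hWsymm : W.IsSymm := hW.isHermitian
  have hpairing := two_mul_trace_mul_mul_transpose hQsymm hQF hWsymm hSW hZ
  have hpos := trace_mul_mul_mul_transpose_pos hQE hW hZ0
  linarith

theorem IsStrictlyPositiveReal.trace_mul_output_nonneg {E : Matrix ι ι ℝ} {F : Matrix ι o ℝ}
    {G : Matrix o ι ℝ} (h : IsStrictlyPositiveReal E F G) {S W : Matrix κ κ ℝ} (hW : W.PosDef)
    (hSW : S * W + W * Sᵀ = 0) {Z : Matrix ι κ ℝ} {s : Matrix o κ ℝ}
    (hZ : Z * S = E * Z + F * s) : 0 ≤ (s * W * (G * Z)ᵀ).trace := by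
  rcases eq_or_ne Z 0 with rfl | hZ0
  · simp
  · exact (h.trace_mul_output_pos hW hSW hZ hZ0).le

theorem sum_trace_mul_transpose_sum_smul (H : Matrix ι κ ℝ) {m n : Type*} [Fintype m] [Fintype n]
    (Y : ι → Matrix m n ℝ) (W : Matrix n n ℝ) (V : κ → Matrix m n ℝ) :
    ∑ i, (Y i * W * (∑ j, H i j • V j)ᵀ).trace = ∑ j, ((∑ i, H i j • Y i) * W * (V j)ᵀ).trace := by
  simp only [transpose_sum, transpose_smul, Matrix.mul_sum, Matrix.sum_mul, Matrix.mul_smul,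
    Matrix.smul_mul, trace_sum, trace_smul]
  exact Finset.sum_comm

namespace NetworkSystem

variable {N M p : ℕ}

/-- The residuals of the mode equations of the edges. A pair `(Z, Y)` stands for edge states
`z j = Z j *ᵥ μ` and node outputs `y i = Y i *ᵥ μ` driven by a mode `μ' = S *ᵥ μ`. The first
component is the defect of the edge dynamics, the second one the negative of the neighboring
inputs. Adding the sum of the node outputs to the latter makes the map bijective for connected
networks. -/
def edgeModeResidual (sys : NetworkSystem N M p) (S : Matrix κ κ ℝ) :
    ((∀ j, Matrix (Fin (sys.ne j)) κ ℝ) × (Fin N → Matrix (Fin p) κ ℝ)) →ₗ[ℝ]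
      ((∀ j, Matrix (Fin (sys.ne j)) κ ℝ) × (Fin N → Matrix (Fin p) κ ℝ)) where
  toFun v := (fun j => v.1 j * S - (sys.E j * v.1 j + sys.F j * ∑ i, sys.H i j • v.2 i),
    fun i => ∑ j, sys.H i j • (sys.G j * v.1 j) + ∑ k, v.2 k)
  map_add' v w := by
    refine Prod.ext (funext fun j => ?_) (funext fun i => ?_) <;>
    · simp only [Prod.fst_add, Prod.snd_add, Pi.add_apply, Matrix.add_mul, Matrix.mul_add,
        smul_add, Finset.sum_add_distrib]
      abel
  map_smul' c v := by
    refine Prod.ext (funext fun j => ?_) (funext fun i => ?_) <;>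
      simp only [Prod.smul_fst, Prod.smul_snd, Pi.smul_apply, Matrix.smul_mul, Matrix.mul_smul,
        RingHom.id_apply, smul_sub, smul_add, smul_comm _ c, ← Finset.smul_sum]

theorem edgeModeResidual_injective {sys : NetworkSystem N M p} {S W : Matrix κ κ ℝ}
    (hW : W.PosDef) (hSW : S * W + W * Sᵀ = 0) (hF : ∀ j, (sys.F j).rank = p)
    (hSPR : ∀ j, IsStrictlyPositiveReal (sys.E j) (sys.F j) (sys.G j)) (hH : sys.Connected) :
    Function.Injective (sys.edgeModeResidual S) := by
  rw [injective_iff_map_eq_zero]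
  rintro ⟨Z, Y⟩ h0
  have hedge (j) : Z j * S = sys.E j * Z j + sys.F j * ∑ i, sys.H i j • Y i :=
    sub_eq_zero.1 (congrFun (congrArg Prod.fst h0) j)
  have hnode (i) : ∑ j, sys.H i j • (sys.G j * Z j) + ∑ k, Y k = 0 :=
    congrFun (congrArg Prod.snd h0) i
  have henergy : ∑ j, ((∑ i, sys.H i j • Y i) * W * (sys.G j * Z j)ᵀ).trace
      + ((∑ k, Y k) * W * (∑ k, Y k)ᵀ).trace = 0 := by
    rw [← sum_trace_mul_transpose_sum_smul, Matrix.sum_mul, Matrix.sum_mul, trace_sum,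
      ← Finset.sum_add_distrib]
    refine Finset.sum_eq_zero fun i _ => ?_
    rw [← trace_add, ← Matrix.mul_add, ← transpose_add, hnode, transpose_zero, Matrix.mul_zero,
      trace_zero]
  have hedge_nonneg (j) : 0 ≤ ((∑ i, sys.H i j • Y i) * W * (sys.G j * Z j)ᵀ).trace :=
    (hSPR j).trace_mul_output_nonneg hW hSW (hedge j)
  have hsum_nonneg := trace_mul_mul_mul_transpose_nonneg PosDef.one hW (∑ k, Y k)
  rw [Matrix.one_mul] at hsum_nonneg
  rw [add_eq_zero_iff_of_nonneg (Finset.sum_nonneg fun j _ => hedge_nonneg j) hsum_nonneg,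
    Finset.sum_eq_zero_iff_of_nonneg fun j _ => hedge_nonneg j] at henergy
  have hZ (j) : Z j = 0 := by
    by_contra hZj
    exact ((hSPR j).trace_mul_output_pos hW hSW (hedge j) hZj).ne' (henergy.1 j (Finset.mem_univ j))
  have hY : ∑ k, Y k = 0 := by
    by_contra hne
    have hpos := trace_mul_mul_mul_transpose_pos PosDef.one hW hne
    rw [Matrix.one_mul] at hpos
    exact hpos.ne' henergy.2
  have hs (j) : ∑ i, sys.H i j • Y i = 0 := by
    refine eq_zero_of_mul_eq_zero_of_rank_eq_card (A := sys.F j) (by simpa using hF j) ?_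
    simpa [hZ j] using (hedge j).symm
  refine Prod.ext (funext hZ) (funext fun i => Matrix.ext fun a c => ?_)
  refine congrFun (hH.eq_zero_of_sum_eq_zero (c := fun i => Y i a c) (funext fun j => ?_) ?_) i
  · simpa [mulVec, dotProduct, Matrix.sum_apply] using congrFun (congrFun (hs j) a) c
  · simpa [Matrix.sum_apply] using congrFun (congrFun hY a) c

theorem exists_edge_steadyState {sys : NetworkSystem N M p} {S W : Matrix κ κ ℝ}
    (hW : W.PosDef) (hSW : S * W + W * Sᵀ = 0) (hF : ∀ j, (sys.F j).rank = p)
    (hSPR : ∀ j, IsStrictlyPositiveReal (sys.E j) (sys.F j) (sys.G j)) (hH : sys.Connected)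
    {b : Fin N → Matrix (Fin p) κ ℝ} (hb : ∑ i, b i = 0) :
    ∃ (Y : Fin N → Matrix (Fin p) κ ℝ) (Z : ∀ j, Matrix (Fin (sys.ne j)) κ ℝ),
      (∀ j, Z j * S = sys.E j * Z j + sys.F j * ∑ i, sys.H i j • Y i) ∧
      ∀ i, -∑ j, sys.H i j • (sys.G j * Z j) = b i := by
  obtain ⟨⟨Z, Y⟩, hZY⟩ := LinearMap.injective_iff_surjective.1
    (edgeModeResidual_injective hW hSW hF hSPR hH) (0, -b)
  have hnode (i) : ∑ j, sys.H i j • (sys.G j * Z j) + ∑ k, Y k = -b i :=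
    congrFun (congrArg Prod.snd hZY) i
  have hY : (N : ℝ) • ∑ k, Y k = 0 := by
    have hsum := Finset.sum_congr rfl fun i (_ : i ∈ Finset.univ) => hnode i
    rw [Finset.sum_add_distrib, Finset.sum_comm, Finset.sum_neg_distrib, hb, neg_zero] at hsum
    simpa only [← Finset.sum_smul, sum_H, zero_smul, Finset.sum_const_zero, zero_add,
      Finset.sum_const, Finset.card_univ, Fintype.card_fin, ← Nat.cast_smul_eq_nsmul ℝ] using hsum
  refine ⟨Y, Z, fun j => sub_eq_zero.1 (congrFun (congrArg Prod.fst hZY) j), fun i => ?_⟩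
  rw [← neg_neg (b i), ← hnode i,
    (smul_eq_zero.1 hY).resolve_left (Nat.cast_ne_zero.2 hH.pos.ne'), add_zero]

end NetworkSystem

end ModeSteadyState

section Lyapunov

theorem eventually_norm_one_add_mul_lt_one {μ : ℂ} (hμ : μ.re < 0) :
    ∀ᶠ h : ℝ in 𝓝[>] 0, ‖1 + (h : ℂ) * μ‖ < 1 := by
  have hcont : Continuous fun h : ℝ => 2 * μ.re + h * Complex.normSq μ := by fun_prop
  have hneg : ∀ᶠ h : ℝ in 𝓝[>] 0, 2 * μ.re + h * Complex.normSq μ < 0 :=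
    nhdsWithin_le_nhds (hcont.continuousAt.eventually_lt_const (by linarith))
  filter_upwards [hneg, self_mem_nhdsWithin] with h hlt (hpos : 0 < h)
  have hsq : ‖1 + (h : ℂ) * μ‖ ^ 2 = 1 + h * (2 * μ.re + h * Complex.normSq μ) := by
    simp only [← Complex.normSq_eq_norm_sq, Complex.normSq_apply, Complex.add_re, Complex.one_re,
      Complex.re_ofReal_mul, Complex.add_im, Complex.one_im, Complex.im_ofReal_mul]
    ring
  rw [← sq_lt_one_iff₀ (norm_nonneg _), hsq]
  linarith [mul_neg_of_pos_of_neg hpos hlt]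

theorem exists_norm_pow_lt_one {R : Type*} [NormedRing R] [NormedAlgebra ℂ R] [CompleteSpace R]
    [Nontrivial R] {a : R} (ha : ∀ μ ∈ spectrum ℂ a, ‖μ‖ < 1) : ∃ k ≠ 0, ‖a ^ k‖ < 1 := by
  have hradius : spectralRadius ℂ a < (1 : NNReal) :=
    spectrum.spectralRadius_lt_of_forall_lt a fun μ hμ => by exact_mod_cast ha μ hμ
  have hgelfand := spectrum.pow_nnnorm_pow_one_div_tendsto_nhds_spectralRadius a
  obtain ⟨k, hk, hk0⟩ :=
    ((hgelfand.eventually_lt_const hradius).and (eventually_ne_atTop 0)).exists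
  refine ⟨k, hk0, ?_⟩
  by_contra! hle
  have hnorm : (1 : ENNReal) ≤ ‖a ^ k‖₊ := by exact_mod_cast hle
  exact hk.not_ge (ENNReal.one_le_rpow hnorm (by positivity))

variable {ι : Type*} [Fintype ι] [DecidableEq ι]

theorem exists_stein_of_pow {B : Matrix ι ι ℝ} {k : ℕ} (hk : k ≠ 0)
    (hB : (1 - (B ^ k)ᵀ * B ^ k).PosDef) :
    ∃ P : Matrix ι ι ℝ, P.PosDef ∧ (P - Bᵀ * P * B).PosDef := by
  have hgram (n : ℕ) : ((B ^ n)ᵀ * B ^ n).PosSemidef := posSemidef_conjTranspose_mul_self (B ^ n)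
  refine ⟨∑ n ∈ Finset.range k, (B ^ n)ᵀ * B ^ n, ?_, ?_⟩
  · obtain ⟨m, rfl⟩ := Nat.exists_eq_succ_of_ne_zero hk
    rw [Finset.sum_range_succ', pow_zero, transpose_one, Matrix.one_mul]
    exact PosDef.one.posSemidef_add (posSemidef_sum _ fun n _ => hgram (n + 1))
  · convert hB using 1
    have htelescope := Finset.sum_range_sub' (fun n => (B ^ n)ᵀ * B ^ n) k
    rw [pow_zero, transpose_one, Matrix.one_mul] at htelescope
    rw [← htelescope, Finset.sum_sub_distrib, Matrix.mul_sum, Matrix.sum_mul]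
    simp only [pow_succ, transpose_mul, Matrix.mul_assoc]

theorem lyapunov_posDef_of_stein {A P : Matrix ι ι ℝ} {h : ℝ} (hh : 0 < h) (hP : P.PosSemidef)
    (hstein : (P - (1 + h • A)ᵀ * P * (1 + h • A)).PosDef) : (-(P * A + Aᵀ * P)).PosDef := by
  have hAPA : (Aᵀ * P * A).PosSemidef := hP.conjTranspose_mul_mul_same A
  convert (hstein.smul (inv_pos.2 hh)).add_posSemidef (hAPA.smul hh.le) using 1
  simp only [transpose_add, transpose_one, transpose_smul, Matrix.add_mul, Matrix.mul_add,
    Matrix.one_mul, Matrix.mul_one, Matrix.smul_mul, Matrix.mul_smul]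
  match_scalars <;> field_simp <;> ring

open scoped Matrix.Norms.L2Operator in
theorem posDef_one_sub_transpose_mul_self {B : Matrix ι ι ℝ}
    (hB : ‖B.map (algebraMap ℝ ℂ)‖ < 1) : (1 - Bᵀ * B).PosDef := by
  refine PosDef.of_dotProduct_mulVec_pos
    (isHermitian_one.sub (isHermitian_conjTranspose_mul_self B)) fun x hx => ?_
  have hnorm (y : ι → ℝ) : ‖WithLp.toLp 2 (fun i => (y i : ℂ))‖ ^ 2 = y ⬝ᵥ y := by
    rw [EuclideanSpace.norm_sq_eq]
    simp [dotProduct, sq]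
  have hmap : B.map (algebraMap ℝ ℂ) *ᵥ (fun i => (x i : ℂ)) = fun i => ((B *ᵥ x) i : ℂ) := by
    ext i
    simp [mulVec, dotProduct]
  have hle : ‖WithLp.toLp 2 (fun i => ((B *ᵥ x) i : ℂ))‖
      ≤ ‖B.map (algebraMap ℝ ℂ)‖ * ‖WithLp.toLp 2 fun i => (x i : ℂ)‖ := by
    rw [← hmap]
    exact l2_opNorm_mulVec (B.map (algebraMap ℝ ℂ)) (WithLp.toLp 2 fun i => (x i : ℂ))
  have hxpos : 0 < ‖WithLp.toLp 2 fun i => (x i : ℂ)‖ := by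
    refine (norm_nonneg _).lt_of_ne' (sq_pos_iff.1 ?_)
    rw [hnorm]
    exact dotProduct_star_self_pos_iff.2 hx
  have hlt : (B *ᵥ x) ⬝ᵥ (B *ᵥ x) < x ⬝ᵥ x := by
    rw [← hnorm, ← hnorm]
    exact pow_lt_pow_left₀ (hle.trans_lt (mul_lt_of_lt_one_left hxpos hB)) (norm_nonneg _)
      two_ne_zero
  rw [star_trivial, sub_mulVec, one_mulVec, dotProduct_sub, ← mulVec_mulVec, dotProduct_mulVec,
    vecMul_transpose]
  exact sub_pos.2 hlt

open scoped Matrix.Norms.L2Operator in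
theorem IsHurwitz.exists_lyapunov {A : Matrix ι ι ℝ} (hA : IsHurwitz A) :
    ∃ P : Matrix ι ι ℝ, P.PosDef ∧ (-(P * A + Aᵀ * P)).PosDef := by
  cases isEmpty_or_nonempty ι
  · exact ⟨1, PosDef.one, (Subsingleton.elim (1 : Matrix ι ι ℝ) _).subst PosDef.one⟩
  have hroots : ∀ᶠ h : ℝ in 𝓝[>] 0, ∀ μ ∈ (A.map (algebraMap ℝ ℂ)).charpoly.roots.toFinset,
      ‖1 + (h : ℂ) * μ‖ < 1 :=
    (eventually_all_finset _).2 fun μ hμ => eventually_norm_one_add_mul_lt_one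
      (hA μ (Polynomial.isRoot_of_mem_roots (Multiset.mem_toFinset.1 hμ)))
  obtain ⟨h, hh, hpos : 0 < h⟩ := (hroots.and self_mem_nhdsWithin).exists
  have hspec : ∀ μ ∈ spectrum ℂ ((1 + h • A).map (algebraMap ℝ ℂ)), ‖μ‖ < 1 := by
    have hmap : (1 + h • A).map (algebraMap ℝ ℂ) = Polynomial.aeval (A.map (algebraMap ℝ ℂ))
        (1 + Polynomial.C (h : ℂ) * Polynomial.X) := by
      ext i j
      simp [Matrix.one_apply, Algebra.algebraMap_eq_smul_one, apply_ite]
    rw [hmap, spectrum.map_polynomial_aeval_of_nonempty _ _ (spectrum.nonempty _)]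
    rintro _ ⟨μ, hμ, rfl⟩
    rw [mem_spectrum_iff_isRoot_charpoly] at hμ
    simpa using hh μ (Multiset.mem_toFinset.2
      ((Polynomial.mem_roots (charpoly_monic _).ne_zero).2 hμ))
  obtain ⟨k, hk, hlt⟩ := exists_norm_pow_lt_one hspec
  rw [← Matrix.map_pow] at hlt
  obtain ⟨P, hP, hstein⟩ := exists_stein_of_pow hk (posDef_one_sub_transpose_mul_self hlt)
  exact ⟨P, hP, lyapunov_posDef_of_stein hpos hP.posSemidef hstein⟩

end Lyapunov

section QuadraticForms

variable {E : Type*} [NormedAddCommGroup E] [NormedSpace ℝ E] [FiniteDimensional ℝ E]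

theorem hasDerivWithinAt_quadraticForm (Q : QuadraticForm ℝ E) {x : ℝ → E} {x' : E} {s : Set ℝ}
    {t : ℝ} (hx : HasDerivWithinAt x x' s t) :
    HasDerivWithinAt (fun τ => Q (x τ)) (QuadraticMap.polar Q (x t) x') s t := by
  set B := Q.polarBilin.toContinuousBilinearMap
  have hB (v w : E) : B v w = QuadraticMap.polar Q v w := rfl
  have hQ (v : E) : Q v = 1 / 2 * B v v := by simp [hB, QuadraticMap.polar_self]
  simp only [hQ, ← hB]
  refine ((B.hasDerivWithinAt_of_bilinear hx hx).const_mul (1 / 2 : ℝ)).congr_deriv ?_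
  rw [hB x' (x t), QuadraticMap.polar_comm, ← hB]
  ring

theorem continuous_polar (Q : QuadraticForm ℝ E) :
    Continuous fun v : E × E => QuadraticMap.polar Q v.1 v.2 :=
  Q.polarBilin.toContinuousBilinearMap.continuous₂

theorem continuous_quadraticForm (Q : QuadraticForm ℝ E) : Continuous Q := by
  have hdiag : Continuous fun x : E => (1 / 2 : ℝ) * QuadraticMap.polar Q x x :=
    continuous_const.mul ((continuous_polar Q).comp (continuous_id.prodMk continuous_id))
  simpa [QuadraticMap.polar_self] using hdiag

theorem exists_le_mul_of_posDef {U : E → ℝ} {V : QuadraticForm ℝ E} (hU : Continuous U)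
    (hsmul : ∀ (a : ℝ) x, U (a • x) = a * a * U x) (hV : V.PosDef) :
    ∃ K > 0, ∀ x, U x ≤ K * V x := by
  have : ProperSpace E := FiniteDimensional.proper ℝ E
  have hne {x : E} (hx : x ∈ Metric.sphere (0 : E) 1) : x ≠ 0 :=
    ne_zero_of_mem_unit_sphere ⟨x, hx⟩
  have hratio : ContinuousOn (fun x => U x / V x) (Metric.sphere 0 1) :=
    hU.continuousOn.div (continuous_quadraticForm V).continuousOn
      fun x hx => (hV x (hne hx)).ne'
  obtain ⟨K, hK⟩ := (isCompact_sphere (0 : E) 1).bddAbove_image hratio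
  refine ⟨max K 1, by positivity, fun x => ?_⟩
  rcases eq_or_ne x 0 with rfl | hx
  · simpa using (hsmul 0 0).le
  have hunit : ‖x‖⁻¹ • x ∈ Metric.sphere (0 : E) 1 := by simp [norm_smul, hx]
  have hle : U (‖x‖⁻¹ • x) / V (‖x‖⁻¹ • x) ≤ max K 1 :=
    (hK (Set.mem_image_of_mem _ hunit)).trans (le_max_left K 1)
  have hscale : ‖x‖⁻¹ * ‖x‖⁻¹ ≠ 0 := by simpa using hx
  rwa [hsmul, QuadraticMap.map_smul, smul_eq_mul,
    mul_div_mul_left _ _ hscale, div_le_iff₀ (hV x hx)] at hle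

theorem exists_norm_sq_le_mul_of_posDef {V : QuadraticForm ℝ E} (hV : V.PosDef) :
    ∃ K > 0, ∀ x, ‖x‖ ^ 2 ≤ K * V x :=
  exists_le_mul_of_posDef (continuous_norm.pow 2)
    (fun a x => by rw [norm_smul, mul_pow, Real.norm_eq_abs, sq_abs, sq a]) hV

variable {ι : Type*} [Fintype ι] [DecidableEq ι]

theorem toQuadraticForm'_eq (P : Matrix ι ι ℝ) (x : ι → ℝ) :
    P.toQuadraticForm' x = x ⬝ᵥ (P *ᵥ x) := by
  simp [toQuadraticForm', toLinearMap₂'_apply']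

theorem polar_toQuadraticForm' {P : Matrix ι ι ℝ} (hP : P.IsSymm) (x y : ι → ℝ) :
    QuadraticMap.polar P.toQuadraticForm' x y = 2 * (x ⬝ᵥ (P *ᵥ y)) := by
  rw [toQuadraticForm', LinearMap.BilinMap.polar_toQuadraticMap, toLinearMap₂'_apply',
    toLinearMap₂'_apply', dotProduct_mulVec y, ← mulVec_transpose, hP.eq, dotProduct_comm, two_mul]

end QuadraticForms

section Convergence

theorem antitoneOn_Ici_of_hasDerivWithinAt_nonpos {f f' : ℝ → ℝ} {a : ℝ}
    (hf : ∀ t ≥ a, HasDerivWithinAt f (f' t) (Set.Ici a) t) (hf' : ∀ t ≥ a, f' t ≤ 0) :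
    AntitoneOn f (Set.Ici a) := by
  refine antitoneOn_of_hasDerivWithinAt_nonpos (f' := f') (convex_Ici a)
    (fun t ht => (hf t ht).continuousWithinAt) (fun t ht => ?_) fun t ht => ?_
  · exact (hf t (interior_subset ht)).mono interior_subset
  · exact hf' t (interior_subset ht)

variable {V V' f f' : ℝ → ℝ} {L : ℝ}

theorem tendsto_sub_add_of_antitoneOn (hV : AntitoneOn V (Set.Ici 0)) (hV0 : ∀ t ≥ 0, 0 ≤ V t)
    (h : ℝ) : Tendsto (fun t => V t - V (t + h)) atTop (𝓝 0) := by
  have hanti : Antitone fun t => V (max t 0) := fun s t hst =>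
    hV (le_max_right s 0) (le_max_right t 0) (max_le_max_right 0 hst)
  have hbdd : BddBelow (Set.range fun t => V (max t 0)) :=
    ⟨0, Set.forall_mem_range.2 fun t => hV0 _ (le_max_right t 0)⟩
  have hlim : Tendsto V atTop (𝓝 (⨅ t, V (max t 0))) := by
    refine (tendsto_atTop_ciInf hanti hbdd).congr' ?_
    filter_upwards [eventually_ge_atTop 0] with t ht
    rw [max_eq_left ht]
  simpa using hlim.sub (hlim.comp (tendsto_atTop_add_const_right atTop h tendsto_id))

theorem mul_sub_sq_le_sub_of_dissipation
    (hV : ∀ t ≥ 0, HasDerivWithinAt V (V' t) (Set.Ici 0) t) (hle : ∀ t ≥ 0, V' t ≤ -f t)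
    (hf : ∀ t ≥ 0, HasDerivWithinAt f (f' t) (Set.Ici 0) t) (hL : ∀ t ≥ 0, -L ≤ f' t)
    {t h : ℝ} (ht : 0 ≤ t) (hh : 0 ≤ h) : h * f t - L / 2 * h ^ 2 ≤ V t - V (t + h) := by
  have hsub : Set.Ici t ⊆ Set.Ici 0 := Set.Ici_subset_Ici.2 ht
  have hlower : ∀ s ≥ t, f t - L * (s - t) ≤ f s := by
    intro s hs
    have := antitoneOn_Ici_of_hasDerivWithinAt_nonpos (f := fun s => -(f s + L * s))
      (fun r hr => ((hf r hr).add ((hasDerivWithinAt_id r _).const_mul L)).neg)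
      (fun r hr => by linarith [hL r hr]) ht (hsub hs) hs
    simp only at this
    linarith
  have := antitoneOn_Ici_of_hasDerivWithinAt_nonpos
    (f := fun s => V s + (f t * (s - t) - L / 2 * (s - t) ^ 2)) (a := t)
    (fun s hs => ((hV s (hsub hs)).mono hsub).add
      ((((hasDerivWithinAt_id s _).sub_const t).const_mul (f t)).sub
        ((((hasDerivWithinAt_id s _).sub_const t).pow 2).const_mul (L / 2))))
    (fun s hs => ?_) Set.self_mem_Ici (Set.mem_Ici.2 (le_add_of_nonneg_right hh))
    (le_add_of_nonneg_right hh)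
  · simp only [sub_self, add_sub_cancel_left] at this
    linarith
  · simp
    linarith [hle s (hsub hs), hlower s hs]

theorem tendsto_zero_of_dissipation (hV : ∀ t ≥ 0, HasDerivWithinAt V (V' t) (Set.Ici 0) t)
    (hV0 : ∀ t ≥ 0, 0 ≤ V t) (hle : ∀ t ≥ 0, V' t ≤ -f t) (hf0 : ∀ t ≥ 0, 0 ≤ f t)
    (hf : ∀ t ≥ 0, HasDerivWithinAt f (f' t) (Set.Ici 0) t) (hL : ∀ t ≥ 0, -L ≤ f' t) :
    Tendsto f atTop (𝓝 0) := by
  have hanti := antitoneOn_Ici_of_hasDerivWithinAt_nonpos hV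
    fun t ht => (hle t ht).trans (neg_nonpos.2 (hf0 t ht))
  refine tendsto_order.2 ⟨fun a ha => ?_, fun δ hδ => ?_⟩
  · filter_upwards [eventually_ge_atTop 0] with t ht using ha.trans_le (hf0 t ht)
  obtain ⟨h, hh, hLh⟩ : ∃ h > 0, L / 2 * h ≤ δ / 2 := by
    refine ⟨δ / (|L| + 1), by positivity, ?_⟩
    rw [mul_div_assoc', div_le_iff₀ (by positivity)]
    nlinarith [le_abs_self L]
  have hdrop : ∀ᶠ t in atTop, V t - V (t + h) < h * (δ / 2) :=
    (tendsto_sub_add_of_antitoneOn hanti hV0 h).eventually_lt_const (by positivity)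
  filter_upwards [eventually_ge_atTop 0, hdrop] with t ht hlt
  have hgain := mul_sub_sq_le_sub_of_dissipation hV hle hf hL ht hh.le
  refine lt_of_mul_lt_mul_left ?_ hh.le
  nlinarith [mul_le_mul_of_nonneg_left hLh hh.le]

theorem tendsto_zero_of_polar_le_neg {E : Type*} [NormedAddCommGroup E] [NormedSpace ℝ E]
    [FiniteDimensional ℝ E] {V f : QuadraticForm ℝ E} {Φ : E → E} {x : ℝ → E} (hV : V.PosDef)
    (hf : ∀ x, 0 ≤ f x) (hΦ : Continuous Φ) (hle : ∀ x, QuadraticMap.polar V x (Φ x) ≤ -f x)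
    (hx : ∀ t ≥ 0, HasDerivWithinAt x (Φ (x t)) (Set.Ici 0) t) :
    Tendsto (fun t => f (x t)) atTop (𝓝 0) := by
  have : ProperSpace E := FiniteDimensional.proper ℝ E
  have hVx (t) (ht : t ≥ 0) := hasDerivWithinAt_quadraticForm V (hx t ht)
  have hanti := antitoneOn_Ici_of_hasDerivWithinAt_nonpos hVx
    fun t _ => (hle (x t)).trans (neg_nonpos.2 (hf (x t)))
  obtain ⟨K, hK, hKle⟩ := exists_norm_sq_le_mul_of_posDef hV
  have hbdd : ∀ t ≥ 0, x t ∈ Metric.closedBall 0 (Real.sqrt (K * V (x 0))) := fun t ht => by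
    rw [mem_closedBall_zero_iff]
    exact Real.le_sqrt_of_sq_le ((hKle (x t)).trans
      (mul_le_mul_of_nonneg_left (hanti Set.self_mem_Ici ht ht) hK.le))
  obtain ⟨L, hL⟩ := (isCompact_closedBall _ _).bddBelow_image
    ((continuous_polar f).comp (continuous_id.prodMk hΦ)).continuousOn
  exact tendsto_zero_of_dissipation hVx (fun t _ => hV.nonneg (x t)) (fun t _ => hle (x t))
    (fun t _ => hf (x t)) (fun t ht => hasDerivWithinAt_quadraticForm f (hx t ht))
    fun t ht => (neg_neg L).trans_le (hL (Set.mem_image_of_mem _ (hbdd t ht)))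

end Convergence

section StrictStorage

variable {ι κ : Type*} [Fintype ι] [Fintype κ]

theorem exists_two_mul_dotProduct_mulVec_le {W : Matrix ι ι ℝ} (hW : W.PosDef) (M : Matrix ι κ ℝ) :
    ∃ K > 0, ∀ (x : ι → ℝ) (u : κ → ℝ), 2 * (x ⬝ᵥ (M *ᵥ u)) ≤ x ⬝ᵥ (W *ᵥ x) + K * (u ⬝ᵥ u) := by
  classical
  obtain ⟨K, hK, hle⟩ := exists_le_mul_of_posDef
    (continuous_quadraticForm (Mᵀ * W⁻¹ * M).toQuadraticForm') (QuadraticMap.map_smul _)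
    (PosDef.one (n := κ) (R := ℝ)).toQuadraticForm'
  refine ⟨K, hK, fun x u => ?_⟩
  have hsymm : Wᵀ = W := hW.isHermitian
  have hcancel : W *ᵥ (W⁻¹ *ᵥ (M *ᵥ u)) = M *ᵥ u := by
    rw [mulVec_mulVec, mul_nonsing_inv _ ((isUnit_iff_isUnit_det W).1 hW.isUnit), one_mulVec]
  have hadjoint : (W⁻¹ *ᵥ (M *ᵥ u)) ⬝ᵥ (W *ᵥ x) = x ⬝ᵥ (M *ᵥ u) := by
    rw [dotProduct_mulVec, ← mulVec_transpose, hsymm, hcancel, dotProduct_comm]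
  have hbound : (W⁻¹ *ᵥ (M *ᵥ u)) ⬝ᵥ (M *ᵥ u) ≤ K * (u ⬝ᵥ u) := by
    simpa only [toQuadraticForm'_eq, one_mulVec, ← mulVec_mulVec, dotProduct_mulVec u,
      vecMul_transpose, dotProduct_comm (M *ᵥ u)] using hle u
  have hsq := hW.posSemidef.dotProduct_mulVec_nonneg (x - W⁻¹ *ᵥ (M *ᵥ u))
  simp only [star_trivial, mulVec_sub, hcancel, dotProduct_sub, sub_dotProduct, hadjoint] at hsq
  linarith

theorem two_mul_dotProduct_mulVec_mulVec {P A : Matrix ι ι ℝ} (hP : P.IsSymm) (x : ι → ℝ) :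
    2 * (x ⬝ᵥ (P *ᵥ (A *ᵥ x))) = x ⬝ᵥ ((P * A + Aᵀ * P) *ᵥ x) := by
  have hadjoint : x ⬝ᵥ (Aᵀ *ᵥ (P *ᵥ x)) = x ⬝ᵥ (P *ᵥ (A *ᵥ x)) := by
    rw [dotProduct_mulVec, vecMul_transpose, dotProduct_mulVec, ← mulVec_transpose, hP.eq,
      dotProduct_comm]
  rw [add_mulVec, dotProduct_add, ← mulVec_mulVec, ← mulVec_mulVec, hadjoint, two_mul]

theorem IsPassive.exists_strict_storage [DecidableEq ι] {A : Matrix ι ι ℝ} {B : Matrix ι κ ℝ}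
    {C : Matrix κ ι ℝ} (h : IsPassive A B C) (hA : IsHurwitz A) (R : Matrix ι κ ℝ) {θ : ℝ}
    (hθ : 0 < θ) :
    ∃ P W : Matrix ι ι ℝ, P.PosDef ∧ W.PosDef ∧ ∀ᶠ ε : ℝ in 𝓝[>] 0, ∀ (x : ι → ℝ) (u : κ → ℝ),
      2 * (x ⬝ᵥ (P *ᵥ (A *ᵥ x + (B - ε • R) *ᵥ u)))
        ≤ 2 * (u ⬝ᵥ (C *ᵥ x)) + θ * (u ⬝ᵥ u) - x ⬝ᵥ (W *ᵥ x) := by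
  obtain ⟨P₀, hP₀, hpassive⟩ := h
  obtain ⟨P₁, hP₁, hW⟩ := hA.exists_lyapunov
  set W := -(P₁ * A + Aᵀ * P₁)
  obtain ⟨K, hK, hKle⟩ := exists_two_mul_dotProduct_mulVec_le hW ((2 : ℝ) • (P₁ * B))
  obtain ⟨δ, hδ, hδK⟩ : ∃ δ > 0, δ * K = θ := ⟨θ / K, by positivity, div_mul_cancel₀ θ hK.ne'⟩
  -- A small multiple of a Lyapunov form for `A` makes the storage function strict.
  set P := P₀ + δ • P₁
  obtain ⟨K', hK', hKle'⟩ := exists_two_mul_dotProduct_mulVec_le hW (-(P * R))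
  refine ⟨P, (δ / 4) • W, (hP₁.smul hδ).posSemidef_add hP₀, hW.smul (by positivity), ?_⟩
  have hsmall : ∀ᶠ ε : ℝ in 𝓝[>] 0, ε < δ / 4 ∧ ε < θ / (2 * K') :=
    nhdsWithin_le_nhds ((gt_mem_nhds (by positivity)).and (gt_mem_nhds (by positivity)))
  filter_upwards [hsmall, self_mem_nhdsWithin] with ε ⟨hεδ, hεK⟩ (hε : 0 < ε) x u
  have hx : 0 ≤ x ⬝ᵥ (W *ᵥ x) := hW.posSemidef.dotProduct_mulVec_nonneg x
  have hu : 0 ≤ u ⬝ᵥ u := dotProduct_star_self_nonneg u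
  have hP₁symm : P₁.IsSymm := hP₁.isHermitian
  have hlyap : 2 * (x ⬝ᵥ (P₁ *ᵥ (A *ᵥ x))) = -(x ⬝ᵥ (W *ᵥ x)) := by
    rw [two_mul_dotProduct_mulVec_mulVec hP₁symm, neg_mulVec, dotProduct_neg, neg_neg]
  have hinput := hKle x u
  have hperturb := hKle' x u
  have hεθ : ε * K' * (u ⬝ᵥ u) ≤ θ / 2 * (u ⬝ᵥ u) := by
    rw [lt_div_iff₀ (by positivity)] at hεK
    exact mul_le_mul_of_nonneg_right (by linarith) hu
  have hsplit : x ⬝ᵥ (P *ᵥ (A *ᵥ x + (B - ε • R) *ᵥ u)) = x ⬝ᵥ (P₀ *ᵥ (A *ᵥ x + B *ᵥ u))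
      + δ * (x ⬝ᵥ (P₁ *ᵥ (A *ᵥ x)) + x ⬝ᵥ (P₁ *ᵥ (B *ᵥ u))) - ε * (x ⬝ᵥ (P *ᵥ (R *ᵥ u))) := by
    simp only [P, add_mulVec, sub_mulVec, smul_mulVec, mulVec_add, mulVec_sub, mulVec_smul,
      dotProduct_add, dotProduct_sub, dotProduct_smul, smul_eq_mul]
    ring
  simp only [neg_mulVec, smul_mulVec, ← mulVec_mulVec, dotProduct_neg, dotProduct_smul,
    smul_eq_mul] at hinput hperturb ⊢
  nlinarith [hpassive x u]

end StrictStorage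

section Interconnection

theorem tendsto_zero_of_posDef {E α : Type*} [NormedAddCommGroup E] [NormedSpace ℝ E]
    [FiniteDimensional ℝ E] {V : QuadraticForm ℝ E} (hV : V.PosDef) {x : α → E} {l : Filter α}
    (h : Tendsto (fun a => V (x a)) l (𝓝 0)) : Tendsto x l (𝓝 0) := by
  obtain ⟨K, -, hK⟩ := exists_norm_sq_le_mul_of_posDef hV
  have hsq : Tendsto (fun a => ‖x a‖ ^ 2) l (𝓝 0) :=
    squeeze_zero (fun a => sq_nonneg _) (fun a => hK (x a)) (by simpa using h.const_mul K)
  refine tendsto_zero_iff_norm_tendsto_zero.2 ?_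
  simpa using hsq.sqrt

variable {I J o : Type*} [Fintype I] [Fintype J] [Fintype o]

theorem sum_dotProduct_sum_smul (H : Matrix I J ℝ) (y : I → o → ℝ) (w : J → o → ℝ) :
    ∑ i, y i ⬝ᵥ ∑ j, H i j • w j = ∑ j, (∑ i, H i j • y i) ⬝ᵥ w j := by
  simp only [dotProduct_sum, sum_dotProduct, dotProduct_smul, smul_dotProduct]
  exact Finset.sum_comm

theorem sum_supply_le {H : Matrix I J ℝ} {w : J → o → ℝ} {θ γ : ℝ}
    (hθ : θ * ∑ i, (∑ j, H i j • w j) ⬝ᵥ (∑ j, H i j • w j) ≤ γ) {v : I → o → ℝ}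
    (hv : ∀ i, v i = -∑ j, H i j • w j) (y : I → o → ℝ) :
    2 * ∑ i, v i ⬝ᵥ y i + θ * ∑ i, v i ⬝ᵥ v i + 2 * ∑ j, (∑ i, H i j • y i) ⬝ᵥ w j ≤ γ := by
  have hpower : ∑ i, v i ⬝ᵥ y i = -∑ j, (∑ i, H i j • y i) ⬝ᵥ w j := by
    simp only [← sum_dotProduct_sum_smul, hv, dotProduct_comm _ (y _), dotProduct_neg,
      Finset.sum_neg_distrib]
  have hgain : ∑ i, v i ⬝ᵥ v i = ∑ i, (∑ j, H i j • w j) ⬝ᵥ (∑ j, H i j • w j) := by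
    simp only [hv, neg_dotProduct, dotProduct_neg, neg_neg]
  rw [hpower, hgain]
  linarith

variable {E : I → Type*} [∀ i, NormedAddCommGroup (E i)] [∀ i, NormedSpace ℝ (E i)]
  {F : J → Type*} [∀ j, NormedAddCommGroup (F j)] [∀ j, NormedSpace ℝ (F j)]

theorem polar_interconnection_le {V f : ∀ i, QuadraticForm ℝ (E i)}
    {U g : ∀ j, QuadraticForm ℝ (F j)} {Φ : ∀ i, E i → (o → ℝ) → E i}
    {Ψ : ∀ j, F j → (o → ℝ) → F j} {y : ∀ i, E i → o → ℝ} {w : ∀ j, F j → o → ℝ}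
    {H : Matrix I J ℝ} {θ : ℝ}
    (hnode : ∀ i x v, QuadraticMap.polar (V i) x (Φ i x v) ≤
      2 * (v ⬝ᵥ y i x) + θ * (v ⬝ᵥ v) - f i x)
    (hedge : ∀ j z s, QuadraticMap.polar (U j) z (Ψ j z s) ≤ 2 * (s ⬝ᵥ w j z) - g j z)
    {z : ∀ j, F j} (hθ : θ * ∑ i, (∑ j, H i j • w j (z j)) ⬝ᵥ (∑ j, H i j • w j (z j)) ≤
      1 / 2 * ∑ j, g j (z j)) (x : ∀ i, E i) :
    QuadraticMap.polar ((QuadraticMap.pi V).prod (QuadraticMap.pi U)) (x, z)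
        (fun i => Φ i (x i) (-∑ j, H i j • w j (z j)),
          fun j => Ψ j (z j) (∑ i, H i j • y i (x i)))
      ≤ -((QuadraticMap.pi f).prod ((1 / 2 : ℝ) • QuadraticMap.pi g)) (x, z) := by
  have hnodes := Finset.sum_le_sum fun i (_ : i ∈ Finset.univ) =>
    hnode i (x i) (-∑ j, H i j • w j (z j))
  have hedges := Finset.sum_le_sum fun j (_ : j ∈ Finset.univ) =>
    hedge j (z j) (∑ i, H i j • y i (x i))
  have hsupply := sum_supply_le hθ (fun i => rfl) fun i => y i (x i)
  simp only [Finset.sum_sub_distrib, Finset.sum_add_distrib, ← Finset.mul_sum] at hnodes hedges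
  simp only [QuadraticMap.polar_prod, QuadraticMap.Ring.polar_pi, QuadraticMap.prod_apply,
    QuadraticMap.pi_apply, _root_.smul_apply, smul_eq_mul]
  linarith

variable [∀ j, FiniteDimensional ℝ (F j)]

theorem exists_smallGain (H : Matrix I J ℝ) (w : ∀ j, F j →ₗ[ℝ] o → ℝ)
    {g : ∀ j, QuadraticForm ℝ (F j)} (hg : ∀ j, (g j).PosDef) :
    ∃ θ > 0, ∀ z : ∀ j, F j,
      θ * ∑ i, (∑ j, H i j • w j (z j)) ⬝ᵥ (∑ j, H i j • w j (z j)) ≤ 1 / 2 * ∑ j, g j (z j) := by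
  have hw (j : J) : Continuous (w j) := (w j).continuous_of_finiteDimensional
  obtain ⟨K, hK, hle⟩ := exists_le_mul_of_posDef (V := QuadraticMap.pi g)
    (U := fun z => ∑ i, (∑ j, H i j • w j (z j)) ⬝ᵥ (∑ j, H i j • w j (z j))) (by fun_prop)
    (fun a z => by
      simp only [Pi.smul_apply, map_smul, smul_comm (H _ _) a, ← Finset.smul_sum,
        smul_dotProduct, dotProduct_smul, smul_eq_mul, ← Finset.mul_sum, mul_assoc])
    (QuadraticMap.posDef_pi_iff.2 hg)
  refine ⟨1 / (2 * K), by positivity, fun z => ?_⟩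
  have hz := hle z
  rw [QuadraticMap.pi_apply] at hz
  rw [div_mul_eq_mul_div, div_le_iff₀ (by positivity)]
  linarith

variable [∀ i, FiniteDimensional ℝ (E i)]

theorem tendsto_zero_of_dissipative_interconnection {V f : ∀ i, QuadraticForm ℝ (E i)}
    {U g : ∀ j, QuadraticForm ℝ (F j)} {Φ : ∀ i, E i → (o → ℝ) → E i}
    {Ψ : ∀ j, F j → (o → ℝ) → F j} {y : ∀ i, E i → o → ℝ} {w : ∀ j, F j → o → ℝ}
    {H : Matrix I J ℝ} {θ : ℝ} (hV : ∀ i, (V i).PosDef) (hU : ∀ j, (U j).PosDef)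
    (hf : ∀ i x, 0 ≤ f i x) (hg : ∀ j z, 0 ≤ g j z)
    (hΦ : ∀ i, Continuous (Function.uncurry (Φ i))) (hΨ : ∀ j, Continuous (Function.uncurry (Ψ j)))
    (hy : ∀ i, Continuous (y i)) (hw : ∀ j, Continuous (w j))
    (hnode : ∀ i x v, QuadraticMap.polar (V i) x (Φ i x v) ≤
      2 * (v ⬝ᵥ y i x) + θ * (v ⬝ᵥ v) - f i x)
    (hedge : ∀ j z s, QuadraticMap.polar (U j) z (Ψ j z s) ≤ 2 * (s ⬝ᵥ w j z) - g j z)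
    (hθ : ∀ z : ∀ j, F j,
      θ * ∑ i, (∑ j, H i j • w j (z j)) ⬝ᵥ (∑ j, H i j • w j (z j)) ≤ 1 / 2 * ∑ j, g j (z j))
    {x : ℝ → ∀ i, E i} {z : ℝ → ∀ j, F j}
    (hx : ∀ i, ∀ t ≥ 0, HasDerivWithinAt (fun τ => x τ i)
      (Φ i (x t i) (-∑ j, H i j • w j (z t j))) (Set.Ici 0) t)
    (hz : ∀ j, ∀ t ≥ 0, HasDerivWithinAt (fun τ => z τ j)
      (Ψ j (z t j) (∑ i, H i j • y i (x t i))) (Set.Ici 0) t) :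
    (∀ i, Tendsto (fun t => f i (x t i)) atTop (𝓝 0)) ∧
      ∀ j, Tendsto (fun t => g j (z t j)) atTop (𝓝 0) := by
  have hlim := tendsto_zero_of_polar_le_neg
    (.prod (QuadraticMap.posDef_pi_iff.2 hV) (QuadraticMap.posDef_pi_iff.2 hU))
    (QuadraticMap.nonneg_prod_iff.2 ⟨QuadraticMap.nonneg_pi_iff.2 hf, fun z =>
      mul_nonneg (by norm_num) (QuadraticMap.nonneg_pi_iff.2 hg z)⟩) (by fun_prop)
    (fun X => polar_interconnection_le hnode hedge (hθ X.2) X.1)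
    (x := fun t => (x t, z t)) fun t ht =>
      (hasDerivWithinAt_pi.2 fun i => hx i t ht).prodMk (hasDerivWithinAt_pi.2 fun j => hz j t ht)
  simp only [QuadraticMap.prod_apply, QuadraticMap.pi_apply, _root_.smul_apply,
    smul_eq_mul] at hlim
  have hfle (t : ℝ) (i : I) : f i (x t i) ≤ ∑ i, f i (x t i) :=
    Finset.single_le_sum (fun i _ => hf i (x t i)) (Finset.mem_univ i)
  have hgle (t : ℝ) (j : J) : g j (z t j) ≤ ∑ j, g j (z t j) :=
    Finset.single_le_sum (fun j _ => hg j (z t j)) (Finset.mem_univ j)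
  have hfsum (t : ℝ) : 0 ≤ ∑ i, f i (x t i) := Finset.sum_nonneg fun i _ => hf i (x t i)
  have hgsum (t : ℝ) : 0 ≤ ∑ j, g j (z t j) := Finset.sum_nonneg fun j _ => hg j (z t j)
  refine ⟨fun i => squeeze_zero (fun t => hf i _) (fun t => ?_) hlim,
    fun j => squeeze_zero (fun t => hg j _) (fun t => ?_) (by simpa using hlim.const_mul 2)⟩
  · linarith [hfle t i, hgsum t]
  · linarith [hgle t j, hfsum t]

end Interconnection

section PassiveNetwork

variable {ι σ o : Type*} [Fintype ι] [Fintype σ] [DecidableEq ι] [Fintype o]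

theorem polar_adaptiveStorage_le [DecidableEq σ] {P W A : Matrix ι ι ℝ} {B R : Matrix ι o ℝ}
    {C : Matrix o ι ℝ} {X S : Matrix σ σ ℝ} {L : Matrix σ o ℝ} {Q : Matrix o σ ℝ} {ε θ : ℝ}
    (hP : P.IsSymm) (hX : X.IsSymm) (hε : 0 < ε)
    (hdiss : ∀ (x : ι → ℝ) (v : o → ℝ), 2 * (x ⬝ᵥ (P *ᵥ (A *ᵥ x + (B - ε • R) *ᵥ v)))
      ≤ 2 * (v ⬝ᵥ (C *ᵥ x)) + θ * (v ⬝ᵥ v) - x ⬝ᵥ (W *ᵥ x))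
    (hS : (-(X * S + Sᵀ * X)).PosSemidef) (hL : X * L = Qᵀ) (x : (ι → ℝ) × (σ → ℝ)) (v : o → ℝ) :
    QuadraticMap.polar (P.toQuadraticForm'.prod (ε⁻¹ • X.toQuadraticForm')) x
        (A *ᵥ x.1 + (B - ε • R) *ᵥ v, S *ᵥ x.2 + ε • (L *ᵥ v))
      ≤ 2 * (v ⬝ᵥ (C *ᵥ x.1 + Q *ᵥ x.2)) + θ * (v ⬝ᵥ v)
        - W.toQuadraticForm'.prod (0 : QuadraticForm ℝ (σ → ℝ)) x := by
  obtain ⟨ξ, η⟩ := x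
  have hdrift : 2 * (η ⬝ᵥ (X *ᵥ (S *ᵥ η))) ≤ 0 := by
    have := hS.dotProduct_mulVec_nonneg η
    rw [neg_mulVec, dotProduct_neg, star_trivial,
      ← two_mul_dotProduct_mulVec_mulVec hX] at this
    exact neg_nonneg.1 this
  have hinput : η ⬝ᵥ (X *ᵥ (L *ᵥ v)) = v ⬝ᵥ (Q *ᵥ η) := by
    rw [mulVec_mulVec, hL, dotProduct_mulVec, vecMul_transpose, dotProduct_comm]
  have hsmul : QuadraticMap.polar (ε⁻¹ • X.toQuadraticForm') η (S *ᵥ η + ε • (L *ᵥ v))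
      = ε⁻¹ * (2 * (η ⬝ᵥ (X *ᵥ (S *ᵥ η)))) + 2 * (v ⬝ᵥ (Q *ᵥ η)) := by
    rw [FunLike.coe_smul, QuadraticMap.polar_smul, smul_eq_mul, polar_toQuadraticForm' hX,
      mulVec_add, mulVec_smul, dotProduct_add, dotProduct_smul, hinput, smul_eq_mul]
    field_simp
  rw [QuadraticMap.polar_prod, polar_toQuadraticForm' hP, hsmul, QuadraticMap.prod_apply,
    _root_.zero_apply, add_zero, toQuadraticForm'_eq, dotProduct_add]
  have := mul_nonpos_of_nonneg_of_nonpos (inv_pos.2 hε).le hdrift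
  linarith [hdiss ξ v]

theorem polar_edgeStorage_eq {Q E : Matrix ι ι ℝ} {F : Matrix ι o ℝ} {G : Matrix o ι ℝ}
    (hQ : Q.IsSymm) (hQF : Q * F = Gᵀ) (z : ι → ℝ) (s : o → ℝ) :
    QuadraticMap.polar Q.toQuadraticForm' z (E *ᵥ z + F *ᵥ s)
      = 2 * (s ⬝ᵥ (G *ᵥ z)) - (-(Q * E + Eᵀ * Q)).toQuadraticForm' z := by
  rw [polar_toQuadraticForm' hQ, mulVec_add, dotProduct_add, mul_add,
    two_mul_dotProduct_mulVec_mulVec hQ, mulVec_mulVec, hQF, dotProduct_mulVec z Gᵀ,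
    vecMul_transpose, dotProduct_comm (G *ᵥ z), toQuadraticForm'_eq, neg_mulVec, dotProduct_neg]
  ring

variable {I J : Type*} [Fintype I] [Fintype J] {n : I → Type*} [∀ i, Fintype (n i)]
  [∀ i, DecidableEq (n i)] {m : J → Type*} [∀ j, Fintype (m j)]

theorem eventually_tendsto_zero_of_isPassive (H : Matrix I J ℝ)
    {A : ∀ i, Matrix (n i) (n i) ℝ} {B : ∀ i, Matrix (n i) o ℝ} {C : ∀ i, Matrix o (n i) ℝ}
    (hA : ∀ i, IsHurwitz (A i)) (hpassive : ∀ i, IsPassive (A i) (B i) (C i))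
    (R : ∀ i, Matrix (n i) o ℝ) {E : ∀ j, Matrix (m j) (m j) ℝ} {F : ∀ j, Matrix (m j) o ℝ}
    {G : ∀ j, Matrix o (m j) ℝ} (hSPR : ∀ j, IsStrictlyPositiveReal (E j) (F j) (G j))
    {X S : Matrix σ σ ℝ} (hX : X.PosDef) (hS : (-(X * S + Sᵀ * X)).PosSemidef)
    {L : Matrix σ o ℝ} {Q : Matrix o σ ℝ} (hL : X * L = Qᵀ) :
    ∀ᶠ ε : ℝ in 𝓝[>] 0, ∀ {ξ : ℝ → ∀ i, n i → ℝ} {η : ℝ → I → σ → ℝ} {z : ℝ → ∀ j, m j → ℝ}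
      {v : ℝ → I → o → ℝ}, (∀ t i, v t i = -∑ j, H i j • (G j *ᵥ z t j)) →
      (∀ i, ∀ t ≥ 0, HasDerivWithinAt (fun τ => ξ τ i)
        (A i *ᵥ ξ t i + (B i - ε • R i) *ᵥ v t i) (Set.Ici 0) t) →
      (∀ i, ∀ t ≥ 0, HasDerivWithinAt (fun τ => η τ i)
        (S *ᵥ η t i + ε • (L *ᵥ v t i)) (Set.Ici 0) t) →
      (∀ j, ∀ t ≥ 0, HasDerivWithinAt (fun τ => z τ j)
        (E j *ᵥ z t j + F j *ᵥ ∑ i, H i j • (C i *ᵥ ξ t i + Q *ᵥ η t i)) (Set.Ici 0) t) →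
      (∀ i, Tendsto (fun t => ξ t i) atTop (𝓝 0)) ∧ ∀ j, Tendsto (fun t => z t j) atTop (𝓝 0) := by
  classical
  choose Y hY hYE hYF using hSPR
  obtain ⟨θ, hθ, hgain⟩ := exists_smallGain H (fun j => (G j).mulVecLin)
    fun j => (hYE j).toQuadraticForm'
  choose P W hP hW hdiss using fun i => (hpassive i).exists_strict_storage (hA i) (R i) hθ
  filter_upwards [eventually_all.2 hdiss, self_mem_nhdsWithin]
    with ε hdiss (hε : 0 < ε) ξ η z v hv hξ hη hz
  obtain ⟨hnodes, hedges⟩ := tendsto_zero_of_dissipative_interconnection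
    (V := fun i => (P i).toQuadraticForm'.prod (ε⁻¹ • X.toQuadraticForm'))
    (f := fun i => (W i).toQuadraticForm'.prod 0)
    (Φ := fun i x v => (A i *ᵥ x.1 + (B i - ε • R i) *ᵥ v, S *ᵥ x.2 + ε • (L *ᵥ v)))
    (Ψ := fun j z s => E j *ᵥ z + F j *ᵥ s) (y := fun i x => C i *ᵥ x.1 + Q *ᵥ x.2)
    (fun i => (hP i).toQuadraticForm'.prod (hX.toQuadraticForm'.smul (inv_pos.2 hε)))
    (fun j => (hY j).toQuadraticForm')
    (fun i => QuadraticMap.nonneg_prod_iff.2 ⟨(hW i).toQuadraticForm'.nonneg, fun _ => le_rfl⟩)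
    (fun j => (hYE j).toQuadraticForm'.nonneg) (fun i => by fun_prop) (fun j => by fun_prop)
    (fun i => by fun_prop) (fun j => (G j).mulVecLin.continuous_of_finiteDimensional)
    (fun i => polar_adaptiveStorage_le (hP i).isHermitian hX.isHermitian hε (hdiss i) hS hL)
    (fun j z s => (polar_edgeStorage_eq (hY j).isHermitian (hYF j) z s).le) hgain
    (x := fun t i => (ξ t i, η t i)) (z := z)
    (fun i t ht => ((hξ i t ht).prodMk (hη i t ht)).congr_deriv
      (by simp only [hv, mulVecLin_apply])) hz
  refine ⟨fun i => tendsto_zero_of_posDef (hW i).toQuadraticForm' ?_,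
    fun j => tendsto_zero_of_posDef (hYE j).toQuadraticForm' (hedges j)⟩
  simpa only [QuadraticMap.prod_apply, _root_.zero_apply, add_zero] using hnodes i

end PassiveNetwork

section Exponential

open scoped Matrix.Norms.Operator

variable {ι : Type*} [Fintype ι] [DecidableEq ι]

theorem hasDerivAt_exp_smul_mulVec (A : Matrix ι ι ℝ) (v : ι → ℝ) (t : ℝ) :
    HasDerivAt (fun τ : ℝ => NormedSpace.exp (τ • A) *ᵥ v)
      (A *ᵥ (NormedSpace.exp (t • A) *ᵥ v)) t := by
  rw [mulVec_mulVec]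
  exact (LinearMap.toContinuousLinearMap
    ((mulVecBilin ℝ ℝ).flip v)).hasFDerivAt.comp_hasDerivAt t (hasDerivAt_exp_smul_const' A t)

theorem eq_exp_mulVec_of_hasDerivWithinAt {A : Matrix ι ι ℝ} {x : ℝ → ι → ℝ}
    (hx : ∀ t ≥ 0, HasDerivWithinAt x (A *ᵥ x t) (Set.Ici 0) t) {t : ℝ} (ht : 0 ≤ t) :
    x t = NormedSpace.exp (t • A) *ᵥ x 0 := by
  let L : (ι → ℝ) →L[ℝ] (ι → ℝ) := LinearMap.toContinuousLinearMap A.mulVecLin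
  have hexp := hasDerivAt_exp_smul_mulVec A (x 0)
  exact ODE_solution_unique_of_mem_Icc_right (v := fun _ => L) (s := fun _ => Set.univ)
    (fun _ _ => L.lipschitz.lipschitzOnWith)
    (fun s hs => ((hx s hs.1).mono fun _ hr => hr.1).continuousWithinAt)
    (fun s hs => (hx s hs.1).mono fun _ hr => hs.1.trans hr) (fun _ _ => Set.mem_univ _)
    (fun s _ => (hexp s).continuousAt.continuousWithinAt) (fun s _ => (hexp s).hasDerivWithinAt)
    (fun _ _ => Set.mem_univ _) (by simp) ⟨ht, le_rfl⟩

end Exponential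

section ClosedLoop

theorem hasDerivWithinAt_matrix_mulVec {ι κ : Type*} [Finite ι] [Fintype κ] {f : ℝ → κ → ℝ}
    {f' : κ → ℝ} {s : Set ℝ} {t : ℝ} (A : Matrix ι κ ℝ) (hf : HasDerivWithinAt f f' s t) :
    HasDerivWithinAt (fun τ => A *ᵥ f τ) (A *ᵥ f') s t := by
  cases nonempty_fintype ι
  exact (LinearMap.toContinuousLinearMap A.mulVecLin).hasFDerivAt.comp_hasDerivWithinAt t hf

theorem hasDerivWithinAt_sumElim {ι κ : Type*} [Finite ι] [Finite κ] {f : ℝ → ι → ℝ}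
    {g : ℝ → κ → ℝ} {f' : ι → ℝ} {g' : κ → ℝ} {s : Set ℝ} {t : ℝ}
    (hf : HasDerivWithinAt f f' s t) (hg : HasDerivWithinAt g g' s t) :
    HasDerivWithinAt (fun τ => Sum.elim (f τ) (g τ)) (Sum.elim f' g') s t := by
  cases nonempty_fintype ι
  cases nonempty_fintype κ
  exact hasDerivWithinAt_pi.2 (Sum.rec (hasDerivWithinAt_pi.1 hf) (hasDerivWithinAt_pi.1 hg))

variable {N M p q : ℕ}

namespace NetworkSystem

variable (sys : NetworkSystem N M p)

theorem neighboringInput_sub (z z' : ∀ j, Fin (sys.ne j) → ℝ) (i : Fin N) :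
    sys.neighboringInput (z - z') i = sys.neighboringInput z i - sys.neighboringInput z' i := by
  simp only [neighboringInput, edgeOutput, Pi.sub_apply, mulVec_sub, smul_sub,
    Finset.sum_sub_distrib, neg_sub, neg_sub_neg]

theorem edgeInput_sub (x x' : ∀ i, Fin (sys.n i) → ℝ) (j : Fin M) :
    sys.edgeInput (x - x') j = sys.edgeInput x j - sys.edgeInput x' j := by
  simp only [edgeInput, nodeOutput, Pi.sub_apply, mulVec_sub, smul_sub, Finset.sum_sub_distrib]

theorem sum_neighboringInput (z : ∀ j, Fin (sys.ne j) → ℝ) :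
    ∑ i, sys.neighboringInput z i = 0 := by
  simp only [neighboringInput, Finset.sum_neg_distrib]
  rw [Finset.sum_comm]
  simp only [← Finset.sum_smul, sum_H, zero_smul, Finset.sum_const_zero, neg_zero]

theorem tendsto_neighboringInput {z : ℝ → ∀ j, Fin (sys.ne j) → ℝ}
    (h : ∀ j, Tendsto (fun t => z t j) atTop (𝓝 0)) (i : Fin N) :
    Tendsto (fun t => sys.neighboringInput (z t) i) atTop (𝓝 0) := by
  have hcont : Continuous fun z => sys.neighboringInput z i := by
    unfold neighboringInput edgeOutput
    fun_prop
  have h0 : sys.neighboringInput 0 i = 0 := by simp [neighboringInput, edgeOutput]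
  exact h0 ▸ (hcont.tendsto 0).comp (tendsto_pi_nhds.2 h)

end NetworkSystem

variable {sys : NetworkSystem N M p} {ctrl : LocalController sys}
  {Sη : Matrix (Fin q) (Fin q) ℝ} {Bη : Matrix (Fin q) (Fin p) ℝ}
  {Qη Qv : Matrix (Fin p) (Fin q) ℝ} {ε : ℝ}
  {x x' : ℝ → ∀ i, Fin (sys.n i) → ℝ} {z z' : ℝ → ∀ j, Fin (sys.ne j) → ℝ}
  {ηbar ηbar' : ℝ → Fin N → Fin p × Fin q → ℝ} {ζ ζ' : ℝ → ∀ i, Fin (ctrl.c i) → ℝ}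
  {ν ν' : ℝ → Fin N → Fin q → ℝ}

theorem IsClosedLoopTrajectory.sub
    (h : IsClosedLoopTrajectory sys ctrl Sη Bη Qη Qv ε x z ηbar ζ ν)
    (h' : IsClosedLoopTrajectory sys ctrl Sη Bη Qη Qv ε x' z' ηbar' ζ' ν') :
    IsClosedLoopTrajectory sys ctrl Sη Bη Qη Qv ε (x - x') (z - z') (ηbar - ηbar') (ζ - ζ')
      (ν - ν') where
  node i t ht := by
    refine ((h.node i t ht).sub (h'.node i t ht)).congr_deriv ?_
    simp only [Pi.sub_apply, NetworkSystem.neighboringInput_sub, mulVec_sub, mulVec_add]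
    abel
  edge j t ht := by
    refine ((h.edge j t ht).sub (h'.edge j t ht)).congr_deriv ?_
    simp only [Pi.sub_apply, NetworkSystem.edgeInput_sub, mulVec_sub]
    abel
  outputReference i t ht := by
    refine ((h.outputReference i t ht).sub (h'.outputReference i t ht)).congr_deriv ?_
    simp only [Pi.sub_apply, NetworkSystem.neighboringInput_sub, mulVec_sub, smul_sub]
    abel
  internalModel i t ht := by
    refine ((h.internalModel i t ht).sub (h'.internalModel i t ht)).congr_deriv ?_
    simp only [Pi.sub_apply, NetworkSystem.nodeOutput, mulVec_sub]
    abel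
  inputReference i t ht := by
    refine ((h.inputReference i t ht).sub (h'.inputReference i t ht)).congr_deriv ?_
    simp only [Pi.sub_apply, mulVec_sub]

theorem IsClosedLoopTrajectory.sum_outputReference
    (h : IsClosedLoopTrajectory sys ctrl Sη Bη Qη Qv ε x z ηbar ζ ν)
    (hν : ∀ t ≥ 0, ∑ i, ν t i = 0) {t : ℝ} (ht : 0 ≤ t) :
    ∑ i, ηbar t i = NormedSpace.exp (t • modelS p Sη) *ᵥ ∑ i, ηbar 0 i := by
  refine eq_exp_mulVec_of_hasDerivWithinAt (x := fun t => ∑ i, ηbar t i) (fun t ht => ?_) ht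
  refine (HasDerivWithinAt.fun_sum fun i _ => h.outputReference i t ht).congr_deriv ?_
  rw [Finset.sum_add_distrib, ← mulVec_sum, ← Finset.smul_sum, ← mulVec_sum,
    Finset.sum_sub_distrib, NetworkSystem.sum_neighboringInput, ← mulVec_sum, hν t ht, mulVec_zero,
    sub_zero, mulVec_zero, smul_zero, add_zero]

theorem IsClosedLoopTrajectory.tendsto_sum_nodeOutput
    (h : IsClosedLoopTrajectory sys ctrl Sη Bη Qη Qv ε x z ηbar ζ ν)
    (hν : ∀ t ≥ 0, ∑ i, ν t i = 0)
    (hy : ∀ i, Tendsto (fun t => sys.nodeOutput (x t) i - modelQ Qη *ᵥ ηbar t i) atTop (𝓝 0)) :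
    Tendsto (fun t => (∑ i, sys.nodeOutput (x t) i)
      - modelQ Qη *ᵥ (NormedSpace.exp (t • modelS p Sη) *ᵥ ∑ i, ηbar 0 i)) atTop (𝓝 0) := by
  have hsum := tendsto_finsetSum Finset.univ fun i _ => hy i
  rw [Finset.sum_const_zero] at hsum
  refine hsum.congr' ?_
  filter_upwards [eventually_ge_atTop 0] with t ht
  rw [Finset.sum_sub_distrib, ← mulVec_sum, h.sum_outputReference hν ht]

end ClosedLoop

section ErrorDynamics

variable {N M p q : ℕ} {sys : NetworkSystem N M p} {ctrl : LocalController sys}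
  {Sη Pη : Matrix (Fin q) (Fin q) ℝ} {Bη : Matrix (Fin q) (Fin p) ℝ}
  {Qη Qv : Matrix (Fin p) (Fin q) ℝ} {ε : ℝ}
  {x : ℝ → ∀ i, Fin (sys.n i) → ℝ} {z : ℝ → ∀ j, Fin (sys.ne j) → ℝ}
  {ηbar : ℝ → Fin N → Fin p × Fin q → ℝ} {ζ : ℝ → ∀ i, Fin (ctrl.c i) → ℝ}
  {ν : ℝ → Fin N → Fin q → ℝ} {i : Fin N}

theorem LocalController.hatC_mulVec_error {X : Matrix (Fin (sys.n i)) (Fin p × Fin q) ℝ}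
    (hC : sys.C i * X = modelQ Qη) (x : ∀ i, Fin (sys.n i) → ℝ) (η : Fin p × Fin q → ℝ)
    (ξ : Fin (ctrl.c i) → ℝ) :
    ctrl.hatC i *ᵥ Sum.elim (x i - X *ᵥ η) ξ = sys.nodeOutput x i - modelQ Qη *ᵥ η := by
  rw [hatC, fromCols_mulVec_sumElim, zero_mulVec, add_zero, mulVec_sub, mulVec_mulVec, hC,
    NetworkSystem.nodeOutput]

theorem IsClosedLoopTrajectory.hasDerivWithinAt_error
    (h : IsClosedLoopTrajectory sys ctrl Sη Bη Qη Qv ε x z ηbar ζ ν)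
    {X : Matrix (Fin (sys.n i)) (Fin p × Fin q) ℝ} {Z : Matrix (Fin (ctrl.c i)) (Fin p × Fin q) ℝ}
    (hX : X * modelS p Sη = sys.A i * X + sys.B i * (ctrl.Kx i * X + ctrl.Kζ i * Z))
    (hZ : Z * modelS p Sη = ctrl.G₁ i * Z) (hC : sys.C i * X = modelQ Qη) {t : ℝ} (ht : 0 ≤ t) :
    HasDerivWithinAt
      (fun τ => Sum.elim (x τ i - X *ᵥ ηbar τ i) (ζ τ i - Z *ᵥ ηbar τ i))
      (ctrl.hatA i *ᵥ Sum.elim (x t i - X *ᵥ ηbar t i) (ζ t i - Z *ᵥ ηbar t i)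
        + (ctrl.hatD i *ᵥ sys.neighboringInput (z t) i
          - ε • (fromRows (X * modelB Bη) (Z * modelB Bη)
            *ᵥ (sys.neighboringInput (z t) i - Qv *ᵥ ν t i)))) (Set.Ici 0) t := by
  have hη := h.outputReference i t ht
  refine (hasDerivWithinAt_sumElim
    ((h.node i t ht).sub (hasDerivWithinAt_matrix_mulVec X hη))
    ((h.internalModel i t ht).sub (hasDerivWithinAt_matrix_mulVec Z hη))).congr_deriv ?_
  have hX' : X *ᵥ (modelS p Sη *ᵥ ηbar t i) = (sys.A i * X
      + sys.B i * (ctrl.Kx i * X + ctrl.Kζ i * Z)) *ᵥ ηbar t i := by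
    rw [mulVec_mulVec, hX]
  have hZ' : Z *ᵥ (modelS p Sη *ᵥ ηbar t i) = (ctrl.G₁ i * Z) *ᵥ ηbar t i := by
    rw [mulVec_mulVec, hZ]
  simp only [LocalController.hatA, LocalController.hatD, fromBlocks_mulVec, fromRows_mulVec,
    zero_mulVec, Sum.elim_comp_inl, Sum.elim_comp_inr, NetworkSystem.nodeOutput, ← hC]
  ext (a | a)
  · simp only [Sum.elim_inl, Pi.sub_apply, Pi.add_apply, Pi.smul_apply, mulVec_add, mulVec_smul,
      hX', mulVec_sub, add_mulVec, ← mulVec_mulVec, smul_eq_mul]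
    ring
  · simp only [Sum.elim_inr, Pi.sub_apply, Pi.add_apply, Pi.smul_apply, Pi.zero_apply, mulVec_add,
      mulVec_smul, hZ', mulVec_sub, ← mulVec_mulVec, smul_eq_mul]
    ring

theorem LocalController.Passifies.eventually_tendsto_zero (hctrl : ctrl.Passifies)
    (hSη : ∀ μ : ℂ, (Sη.map (algebraMap ℝ ℂ)).charpoly.IsRoot μ → 0 ≤ μ.re)
    (hSPR : ∀ j, IsStrictlyPositiveReal (sys.E j) (sys.F j) (sys.G j))
    (hIM : ∀ i, IncorporatesPCopy Sη (ctrl.G₁ i) (ctrl.G₂ i)) (hPη : Pη.PosDef)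
    (hGS : (-(((1 : Matrix (Fin p) (Fin p) ℝ) ⊗ₖ Pη) * modelS p Sη
      + (modelS p Sη)ᵀ * ((1 : Matrix (Fin p) (Fin p) ℝ) ⊗ₖ Pη))).PosSemidef)
    (hGB : ((1 : Matrix (Fin p) (Fin p) ℝ) ⊗ₖ Pη) * modelB Bη = (modelQ Qη)ᵀ)
    (Qv : Matrix (Fin p) (Fin q) ℝ) :
    ∀ᶠ ε : ℝ in 𝓝[>] 0, ∀ {x : ℝ → ∀ i, Fin (sys.n i) → ℝ}
      {z : ℝ → ∀ j, Fin (sys.ne j) → ℝ} {ηbar : ℝ → Fin N → Fin p × Fin q → ℝ}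
      {ζ : ℝ → ∀ i, Fin (ctrl.c i) → ℝ},
      IsClosedLoopTrajectory sys ctrl Sη Bη Qη Qv ε x z ηbar ζ 0 →
      (∀ i, Tendsto (fun t => sys.neighboringInput (z t) i) atTop (𝓝 0)) ∧
      ∀ i, Tendsto (fun t => sys.nodeOutput (x t) i - modelQ Qη *ᵥ ηbar t i) atTop (𝓝 0) := by
  choose X Z hX hZ hC using fun i => (hIM i).exists_regulator (aeval_modelS_minpoly p Sη)
    ((hctrl i).1.isCoprime_charpoly_minpoly hSη) 0 (modelQ Qη)
  filter_upwards [eventually_tendsto_zero_of_isPassive sys.H (fun i => (hctrl i).1)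
    (fun i => (hctrl i).2) (fun i => fromRows (X i * modelB Bη) (Z i * modelB Bη)) hSPR
    (PosDef.one.kronecker hPη) hGS hGB] with ε hε x z ηbar ζ h
  obtain ⟨herror, hedge⟩ := hε
    (ξ := fun t i => Sum.elim (x t i - X i *ᵥ ηbar t i) (ζ t i - Z i *ᵥ ηbar t i))
    (η := ηbar) (z := z) (v := fun t => sys.neighboringInput (z t)) (fun _ _ => rfl)
    (fun i t ht => (h.hasDerivWithinAt_error (by simpa using hX i) (hZ i) (hC i) ht).congr_deriv
      (by simp [sub_mulVec, smul_mulVec]))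
    (fun i t ht => (h.outputReference i t ht).congr_deriv (by simp))
    (fun j t ht => (h.edge j t ht).congr_deriv
      (by simp only [ctrl.hatC_mulVec_error (hC _), sub_add_cancel, NetworkSystem.edgeInput]))
  refine ⟨sys.tendsto_neighboringInput hedge, fun i => ?_⟩
  have hcont : Continuous fun a => ctrl.hatC i *ᵥ a := by fun_prop
  simpa [Function.comp_def, ctrl.hatC_mulVec_error (hC i)] using
    (hcont.tendsto 0).comp (herror i)

theorem LocalController.Passifies.eventually_tendsto_sub (hctrl : ctrl.Passifies)
    (hSη : ∀ μ : ℂ, (Sη.map (algebraMap ℝ ℂ)).charpoly.IsRoot μ → 0 ≤ μ.re)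
    (hSPR : ∀ j, IsStrictlyPositiveReal (sys.E j) (sys.F j) (sys.G j))
    (hIM : ∀ i, IncorporatesPCopy Sη (ctrl.G₁ i) (ctrl.G₂ i)) (hPη : Pη.PosDef)
    (hGS : (-(((1 : Matrix (Fin p) (Fin p) ℝ) ⊗ₖ Pη) * modelS p Sη
      + (modelS p Sη)ᵀ * ((1 : Matrix (Fin p) (Fin p) ℝ) ⊗ₖ Pη))).PosSemidef)
    (hGB : ((1 : Matrix (Fin p) (Fin p) ℝ) ⊗ₖ Pη) * modelB Bη = (modelQ Qη)ᵀ)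
    (Qv : Matrix (Fin p) (Fin q) ℝ) :
    ∀ᶠ ε : ℝ in 𝓝[>] 0, ∀ {x x' : ℝ → ∀ i, Fin (sys.n i) → ℝ}
      {z z' : ℝ → ∀ j, Fin (sys.ne j) → ℝ} {ηbar ηbar' : ℝ → Fin N → Fin p × Fin q → ℝ}
      {ζ ζ' : ℝ → ∀ i, Fin (ctrl.c i) → ℝ} {ν : ℝ → Fin N → Fin q → ℝ},
      IsClosedLoopTrajectory sys ctrl Sη Bη Qη Qv ε x z ηbar ζ ν →
      IsClosedLoopTrajectory sys ctrl Sη Bη Qη Qv ε x' z' ηbar' ζ' ν →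
      (∀ i, Tendsto (fun t => sys.neighboringInput (z t) i - sys.neighboringInput (z' t) i)
        atTop (𝓝 0)) ∧
      ∀ i, Tendsto (fun t => (sys.nodeOutput (x t) i - modelQ Qη *ᵥ ηbar t i)
        - (sys.nodeOutput (x' t) i - modelQ Qη *ᵥ ηbar' t i)) atTop (𝓝 0) := by
  filter_upwards [hctrl.eventually_tendsto_zero hSη hSPR hIM hPη hGS hGB Qv]
    with ε hε x x' z z' ηbar ηbar' ζ ζ' ν h h'
  have hsub := h.sub h'
  rw [sub_self] at hsub
  obtain ⟨hv, hy⟩ := hε hsub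
  refine ⟨fun i => by simpa only [Pi.sub_apply, NetworkSystem.neighboringInput_sub] using hv i,
    fun i => (hy i).congr fun t => ?_⟩
  simp only [NetworkSystem.nodeOutput, Pi.sub_apply, mulVec_sub]
  abel

end ErrorDynamics

section SteadyState

variable {N M p q : ℕ} {sys : NetworkSystem N M p} {ctrl : LocalController sys}
  {Sη Pη : Matrix (Fin q) (Fin q) ℝ} {Bη : Matrix (Fin q) (Fin p) ℝ} {Qη : Matrix (Fin p) (Fin q) ℝ}

/-- The regulator equations of the network: along an exosystem `μ' = S *ᵥ μ` the node, edge,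
output reference and internal model states `X i *ᵥ μ`, `Z j *ᵥ μ`, `W i *ᵥ μ`, `V i *ᵥ μ` form a
closed-loop solution whose neighboring inputs are `b i *ᵥ μ` and whose tracking errors vanish. -/
structure IsSteadyState {κ : Type*} [Fintype κ] (sys : NetworkSystem N M p)
    (ctrl : LocalController sys) (Sη : Matrix (Fin q) (Fin q) ℝ) (Qη : Matrix (Fin p) (Fin q) ℝ)
    (S : Matrix κ κ ℝ) (b : Fin N → Matrix (Fin p) κ ℝ) (X : ∀ i, Matrix (Fin (sys.n i)) κ ℝ)
    (Z : ∀ j, Matrix (Fin (sys.ne j)) κ ℝ) (W : Fin N → Matrix (Fin p × Fin q) κ ℝ)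
    (V : ∀ i, Matrix (Fin (ctrl.c i)) κ ℝ) : Prop where
  node : ∀ i, X i * S
    = sys.A i * X i + sys.B i * (ctrl.Kx i * X i + ctrl.Kζ i * V i) + sys.D i * b i
  edge : ∀ j, Z j * S = sys.E j * Z j + sys.F j * ∑ i, sys.H i j • (sys.C i * X i)
  outputReference : ∀ i, modelS p Sη * W i = W i * S
  internalModel : ∀ i, V i * S = ctrl.G₁ i * V i
  neighboringInput : ∀ i, -∑ j, sys.H i j • (sys.G j * Z j) = b i
  nodeOutput : ∀ i, sys.C i * X i = modelQ Qη * W i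

namespace IsSteadyState

variable {κ : Type*} [Fintype κ] {S : Matrix κ κ ℝ} {b : Fin N → Matrix (Fin p) κ ℝ}
  {X : ∀ i, Matrix (Fin (sys.n i)) κ ℝ} {Z : ∀ j, Matrix (Fin (sys.ne j)) κ ℝ}
  {W : Fin N → Matrix (Fin p × Fin q) κ ℝ} {V : ∀ i, Matrix (Fin (ctrl.c i)) κ ℝ}

theorem neighboringInput_mulVec (h : IsSteadyState sys ctrl Sη Qη S b X Z W V) (μ : κ → ℝ)
    (i : Fin N) : sys.neighboringInput (fun j => Z j *ᵥ μ) i = b i *ᵥ μ := by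
  simp only [← h.neighboringInput, NetworkSystem.neighboringInput, NetworkSystem.edgeOutput,
    mulVec_mulVec, neg_mulVec, sum_mulVec, smul_mulVec]

theorem nodeOutput_mulVec (h : IsSteadyState sys ctrl Sη Qη S b X Z W V) (μ : κ → ℝ) (i : Fin N) :
    sys.nodeOutput (fun i => X i *ᵥ μ) i = modelQ Qη *ᵥ (W i *ᵥ μ) := by
  rw [NetworkSystem.nodeOutput, mulVec_mulVec, mulVec_mulVec, h.nodeOutput]

theorem isClosedLoopTrajectory (h : IsSteadyState sys ctrl Sη Qη S b X Z W V) {μ : ℝ → κ → ℝ}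
    (hμ : ∀ t ≥ 0, HasDerivWithinAt μ (S *ᵥ μ t) (Set.Ici 0) t) {Qv : Matrix (Fin p) (Fin q) ℝ}
    {ν : ℝ → Fin N → Fin q → ℝ}
    (hν : ∀ i, ∀ t ≥ 0, HasDerivWithinAt (fun τ => ν τ i) (Sη *ᵥ ν t i) (Set.Ici 0) t)
    (hb : ∀ t ≥ 0, ∀ i, b i *ᵥ μ t = Qv *ᵥ ν t i) (Bη : Matrix (Fin q) (Fin p) ℝ) (ε : ℝ) :
    IsClosedLoopTrajectory sys ctrl Sη Bη Qη Qv ε (fun t i => X i *ᵥ μ t) (fun t j => Z j *ᵥ μ t)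
      (fun t i => W i *ᵥ μ t) (fun t i => V i *ᵥ μ t) ν where
  node i t ht := by
    refine (hasDerivWithinAt_matrix_mulVec (X i) (hμ t ht)).congr_deriv ?_
    simp only [h.neighboringInput_mulVec, mulVec_mulVec, ← add_mulVec, h.node]
  edge j t ht := by
    refine (hasDerivWithinAt_matrix_mulVec (Z j) (hμ t ht)).congr_deriv ?_
    simp only [NetworkSystem.edgeInput, NetworkSystem.nodeOutput, mulVec_mulVec, ← smul_mulVec,
      ← sum_mulVec, ← add_mulVec, h.edge]
  outputReference i t ht := by
    refine (hasDerivWithinAt_matrix_mulVec (W i) (hμ t ht)).congr_deriv ?_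
    rw [h.neighboringInput_mulVec, hb t ht, sub_self, mulVec_zero, smul_zero, add_zero,
      mulVec_mulVec, mulVec_mulVec, h.outputReference]
  internalModel i t ht := by
    refine (hasDerivWithinAt_matrix_mulVec (V i) (hμ t ht)).congr_deriv ?_
    rw [h.nodeOutput_mulVec, sub_self, mulVec_zero, add_zero, mulVec_mulVec, mulVec_mulVec,
      h.internalModel]
  inputReference := hν

end IsSteadyState

theorem exists_isSteadyState (hF : ∀ j, (sys.F j).rank = p)
    (hSη : ∀ μ : ℂ, (Sη.map (algebraMap ℝ ℂ)).charpoly.IsRoot μ → 0 ≤ μ.re)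
    (hSPR : ∀ j, IsStrictlyPositiveReal (sys.E j) (sys.F j) (sys.G j)) (hH : sys.Connected)
    (hIM : ∀ i, IncorporatesPCopy Sη (ctrl.G₁ i) (ctrl.G₂ i)) (hctrl : ctrl.Passifies)
    (hPη : Pη.PosDef) (hPS : Pη * Sη + Sηᵀ * Pη = 0)
    (hGctrb : IsControllable (modelS p Sη) (modelB Bη))
    (hGB : ((1 : Matrix (Fin p) (Fin p) ℝ) ⊗ₖ Pη) * modelB Bη = (modelQ Qη)ᵀ) {r : ℕ}
    {b : Fin N → Matrix (Fin p) (Fin r × Fin q) ℝ} (hb : ∑ i, b i = 0) :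
    ∃ X Z W V, IsSteadyState sys ctrl Sη Qη (modelS r Sη) b X Z W V := by
  have hP : ((1 : Matrix (Fin r) (Fin r) ℝ) ⊗ₖ Pη).PosDef := PosDef.one.kronecker hPη
  have hPSr : ((1 : Matrix (Fin r) (Fin r) ℝ) ⊗ₖ Pη) * modelS r Sη
      + (modelS r Sη)ᵀ * ((1 : Matrix (Fin r) (Fin r) ℝ) ⊗ₖ Pη) = 0 := by
    rw [lyapunov_modelS, hPS, kronecker_zero]
  obtain ⟨Y, Z, hZ, hZb⟩ := NetworkSystem.exists_edge_steadyState hP.inv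
    (mul_inv_add_inv_mul_transpose_eq_zero ((isUnit_iff_isUnit_det _).1 hP.isUnit) hPSr) hF hSPR
    hH hb
  choose W hW hWY using fun i => exists_model_realization hPη hPS hGctrb hGB (Y i)
  choose X V hX hV hC using fun i => (hIM i).exists_regulator (aeval_modelS_minpoly r Sη)
    ((hctrl i).1.isCoprime_charpoly_minpoly hSη) (sys.D i * b i) (Y i)
  exact ⟨X, Z, W, V, hX, fun j => by simp only [hC, hZ], hW, hV, hZb, fun i => by rw [hC, hWY]⟩

/-- The reference map of the stacked exosystem `modelS N S`, whose state `(ν k)ₖ` collects the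
references of all nodes. Subtracting the mean changes nothing along references of zero sum and
makes the maps of the nodes sum to zero. -/
noncomputable def stackedReference (Qv : Matrix (Fin p) (Fin q) ℝ) (i : Fin N) :
    Matrix (Fin p) (Fin N × Fin q) ℝ :=
  Matrix.of fun a kb => ((if i = kb.1 then 1 else 0) - (N : ℝ)⁻¹) * Qv a kb.2

theorem sum_stackedReference (Qv : Matrix (Fin p) (Fin q) ℝ) :
    ∑ i : Fin N, stackedReference Qv i = 0 := by
  ext a ⟨k, b⟩
  have : NeZero N := ⟨(Nat.zero_le _).trans_lt k.2 |>.ne'⟩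
  simp [stackedReference, Matrix.sum_apply, ← Finset.sum_mul]

theorem stackedReference_mulVec (Qv : Matrix (Fin p) (Fin q) ℝ) {ν : Fin N → Fin q → ℝ}
    (hν : ∑ i, ν i = 0) (i : Fin N) :
    stackedReference Qv i *ᵥ (fun kb => ν kb.1 kb.2) = Qv *ᵥ ν i := by
  have hblocks : stackedReference Qv i *ᵥ (fun kb => ν kb.1 kb.2)
      = ∑ k, ((if i = k then 1 else 0) - (N : ℝ)⁻¹) • (Qv *ᵥ ν k) := by
    ext a
    simp [stackedReference, mulVec, dotProduct, Fintype.sum_prod_type, Finset.mul_sum, mul_assoc]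
  simp only [hblocks, sub_smul, ite_smul, one_smul, zero_smul, Finset.sum_sub_distrib,
    Finset.sum_ite_eq, Finset.mem_univ, if_true, ← Finset.smul_sum, ← mulVec_sum, hν, mulVec_zero,
    smul_zero, sub_zero]

theorem hasDerivWithinAt_stacked {S : Matrix (Fin q) (Fin q) ℝ} {ν : ℝ → Fin N → Fin q → ℝ}
    {s : Set ℝ} {t : ℝ} (h : ∀ i, HasDerivWithinAt (fun τ => ν τ i) (S *ᵥ ν t i) s t) :
    HasDerivWithinAt (fun τ (kb : Fin N × Fin q) => ν τ kb.1 kb.2)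
      (modelS N S *ᵥ fun kb => ν t kb.1 kb.2) s t := by
  refine hasDerivWithinAt_pi.2 fun kb => (hasDerivWithinAt_pi.1 (h kb.1) kb.2).congr_deriv ?_
  simp [modelS, mulVec, dotProduct, Fintype.sum_prod_type, kroneckerMap_apply, one_apply]

theorem exists_reference_trajectory {N M p q : ℕ} {sys : NetworkSystem N M p}
    {ctrl : LocalController sys} {Sη Pη : Matrix (Fin q) (Fin q) ℝ}
    {Bη : Matrix (Fin q) (Fin p) ℝ} {Qη Qv : Matrix (Fin p) (Fin q) ℝ}
    (hF : ∀ j, (sys.F j).rank = p)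
    (hSη : ∀ μ : ℂ, (Sη.map (algebraMap ℝ ℂ)).charpoly.IsRoot μ → 0 ≤ μ.re)
    (hSPR : ∀ j, IsStrictlyPositiveReal (sys.E j) (sys.F j) (sys.G j)) (hH : sys.Connected)
    (hIM : ∀ i, IncorporatesPCopy Sη (ctrl.G₁ i) (ctrl.G₂ i)) (hctrl : ctrl.Passifies)
    (hPη : Pη.PosDef) (hPS : Pη * Sη + Sηᵀ * Pη = 0)
    (hGctrb : IsControllable (modelS p Sη) (modelB Bη))
    (hGB : ((1 : Matrix (Fin p) (Fin p) ℝ) ⊗ₖ Pη) * modelB Bη = (modelQ Qη)ᵀ)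
    {ν : ℝ → Fin N → Fin q → ℝ}
    (hν : ∀ i, ∀ t ≥ 0, HasDerivWithinAt (fun τ => ν τ i) (Sη *ᵥ ν t i) (Set.Ici 0) t)
    (hsum : ∀ t ≥ 0, ∑ i, ν t i = 0) (ε : ℝ) :
    ∃ x z ηbar ζ, IsClosedLoopTrajectory sys ctrl Sη Bη Qη Qv ε x z ηbar ζ ν ∧
      (∀ t ≥ 0, ∀ i, sys.neighboringInput (z t) i = Qv *ᵥ ν t i) ∧
      ∀ t i, sys.nodeOutput (x t) i = modelQ Qη *ᵥ ηbar t i := by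
  obtain ⟨X, Z, W, V, h⟩ := exists_isSteadyState hF hSη hSPR hH hIM hctrl hPη hPS hGctrb hGB
    (sum_stackedReference Qv)
  have hb (t) (ht : t ≥ 0) (i) := stackedReference_mulVec Qv (hsum t ht) i
  exact ⟨_, _, _, _, h.isClosedLoopTrajectory
    (fun t ht => hasDerivWithinAt_stacked fun i => hν i t ht) hν hb Bη ε,
    fun t ht i => (h.neighboringInput_mulVec _ i).trans (hb t ht i),
    fun t i => h.nodeOutput_mulVec _ i⟩

end SteadyState

theorem mainTheorem1 {N M p q : ℕ} (sys : NetworkSystem N M p) (ctrl : LocalController sys)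
    (Sη Pη : Matrix (Fin q) (Fin q) ℝ) (Bη : Matrix (Fin q) (Fin p) ℝ)
    (Qη Qv : Matrix (Fin p) (Fin q) ℝ)
    (hA1 : sys.FullRank)
    (hA2 : HasSimpleImaginarySpectrum Sη)
    (hA3 : ∀ j, IsStrictlyPositiveReal (sys.E j) (sys.F j) (sys.G j))
    (hA4 : sys.Connected)
    (hIM : ∀ i, IncorporatesPCopy Sη (ctrl.G₁ i) (ctrl.G₂ i))
    (hA5 : ctrl.Passifies)
    (hPη : Pη.PosDef)
    (hGctrb : IsControllable (modelS p Sη) (modelB Bη))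
    (hGcopy : IncorporatesPCopy Sη (modelS p Sη) (modelB Bη))
    (hGS : (-(((1 : Matrix (Fin p) (Fin p) ℝ) ⊗ₖ Pη) * modelS p Sη
      + (modelS p Sη)ᵀ * ((1 : Matrix (Fin p) (Fin p) ℝ) ⊗ₖ Pη))).PosSemidef)
    (hGB : ((1 : Matrix (Fin p) (Fin p) ℝ) ⊗ₖ Pη) * modelB Bη = (modelQ Qη)ᵀ) :
    ∃ εstar : ℝ, 0 < εstar ∧ ∀ ε : ℝ, 0 < ε → ε < εstar →
      ∀ (x : ℝ → ∀ i, Fin (sys.n i) → ℝ) (z : ℝ → ∀ j, Fin (sys.ne j) → ℝ)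
        (ηbar : ℝ → Fin N → Fin p × Fin q → ℝ) (ζ : ℝ → ∀ i, Fin (ctrl.c i) → ℝ)
        (ν : ℝ → Fin N → Fin q → ℝ),
        IsClosedLoopTrajectory sys ctrl Sη Bη Qη Qv ε x z ηbar ζ ν →
        (∀ t ≥ 0, ∑ i, ν t i = 0) →
        (∀ i, Tendsto (fun t => sys.neighboringInput (z t) i - Qv *ᵥ ν t i) atTop (𝓝 0)) ∧
        Tendsto (fun t => (∑ i, sys.nodeOutput (x t) i)
          - modelQ Qη *ᵥ (NormedSpace.exp (t • modelS p Sη) *ᵥ ∑ i, ηbar 0 i)) atTop (𝓝 0) := by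
  rcases eq_or_ne p 0 with rfl | hp
  · exact ⟨1, one_pos, fun ε _ _ x z ηbar ζ ν _ _ =>
      ⟨fun i => tendsto_const_nhds.congr fun t => Subsingleton.elim _ _,
        tendsto_const_nhds.congr fun t => Subsingleton.elim _ _⟩⟩
  have : NeZero p := ⟨hp⟩
  have hPS : Pη * Sη + Sηᵀ * Pη = 0 := lyapunov_eq_zero_of_trace_eq_zero hPη
    (trace_eq_zero_of_forall_re_eq_zero fun μ hμ => (hA2 μ hμ).1)
    (lyapunov_posSemidef_of_modelS hGS)
  have hre (μ : ℂ) (hμ : (Sη.map (algebraMap ℝ ℂ)).charpoly.IsRoot μ) : 0 ≤ μ.re :=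
    (hA2 μ hμ).1.ge
  obtain ⟨εstar, hεstar, hstable⟩ := (nhdsGT_basis (0 : ℝ)).eventually_iff.1
    (hA5.eventually_tendsto_sub hre hA3 hIM hPη hGS hGB Qv)
  refine ⟨εstar, hεstar, fun ε hε hlt x z ηbar ζ ν h hsum => ?_⟩
  obtain ⟨x', z', ηbar', ζ', h', hv', hy'⟩ := exists_reference_trajectory (fun j => (hA1.2 j).1)
    hre hA3 hA4 hIM hA5 hPη hPS hGctrb hGB h.inputReference hsum ε
  obtain ⟨hv, hy⟩ := hstable ⟨hε, hlt⟩ h h'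
  refine ⟨fun i => (hv i).congr' ?_, h.tendsto_sum_nodeOutput hsum fun i => ?_⟩
  · filter_upwards [eventually_ge_atTop 0] with t ht
    rw [hv' t ht]
  · simpa only [hy', sub_self, sub_zero] using hy i
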